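/- **Theorem (failure of a Ros-type theorem in warped product spaces).** Let $n\ge 2$, let $I\subseteq(0,\infty)$ be open and let $f:I\to(0,\infty)$ be smooth. Consider the warped product space $\{x\in\mathbb R^n : |x|\in I\}$ with the metric $$ds^2=\frac{1}{f(\rho)^2}\,d\rho^2+\rho^2\,dS_{n-1}^2,\qquad \rho=|x|,$$ where $dS_{n-1}^2$ is the standard metric of the unit sphere $\mathbb S^{n-1}$. Let $r\in I$ satisfy $$\frac{f(r)f'(r)}{r}+\frac{1-f(r)^2}{r^2}\neq 0 .$$ Then the slice sphere of radius $r$, parametrized by $\iota_r:\mathbb S^{n-1}\to\mathbb R^n$, $\iota_r(p)=rp$, has constant scalar curvature $\frac{(n-1)(n-2)}{r^2}$ in the induced metric. Moreover, for every $k\in\mathbb N$ and $\delta>0$ there is a smooth embedding $Y$ of $\mathbb S^{n-1}$ into the warped product space, with $\|Y-\iota_r\|_{C^k(\mathbb S^{n-1})}<\delta$, such that 1. $Y$ has an outer unit normal, pointing everywhere strictly away from the origin, and is strictly convex: its second fundamental form with respect to that normal (with the sign for which slice spheres have positive second fundamental form) is positive definite everywhere; 2. the metric induced by $Y$ on $\mathbb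 S^{n-1}$ equals the one induced by $\iota_r$, and it has the same constant scalar curvature $\frac{(n-1)(n-2)}{r^2}$; 3. the second fundamental forms of $Y$ and of $\iota_r$, as tensors on $\mathbb S^{n-1}$, are different; 4. the image of $Y$ is not a sphere $\{|x|=\rho\}$ for any $\rho$. In particular, hypersurfaces of constant scalar curvature in such a space need not be round slice spheres. -/

import Mathlib

open scoped ContDiff Manifold RealInnerProductSpace

noncomputable section

namespace WarpedProduct

/-- Cartesian `d`-space with the Euclidean norm. -/
abbrev E (d : ℕ) : Type := EuclideanSpace ℝ (Fin d)

/-- The unit sphere `S^m` in `ℝ^(m+1)`. -/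
abbrev S (m : ℕ) : Type := Metric.sphere (0 : E (m + 1)) 1

/-! ### The ambient warped product metric -/

/-- The differential of the radius function `x ↦ ‖x‖` at `x ≠ 0`, applied to `u`. -/
def dr {d : ℕ} (x u : E d) : ℝ := ⟪x, u⟫ / ‖x‖

/-- The warped product metric `dr² / f(r)² + r² dS²` at the point `x ≠ 0`, in Cartesian
coordinates; here `r² dS² = ⟪·,·⟫ - dr²`, where `⟪·,·⟫` is the Euclidean inner product. -/
def metric {d : ℕ} (f : ℝ → ℝ) (x u v : E d) : ℝ :=
  dr x u * dr x v / f ‖x‖ ^ 2 + (⟪u, v⟫ - dr x u * dr x v)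

/-- The Christoffel symbol of the first kind of the warped product metric in Cartesian coordinates:
`metric f x (D_U V) w` for the Levi-Civita connection `D` and the constant vector fields
`U = u`, `V = v`. -/
def christoffelFirst {d : ℕ} (f : ℝ → ℝ) (x u v w : E d) : ℝ :=
  (fderiv ℝ (fun y => metric f y v w) x u + fderiv ℝ (fun y => metric f y u w) x v
    - fderiv ℝ (fun y => metric f y u v) x w) / 2

/-! ### Hypersurfaces parametrized by the unit sphere -/

/-- The extension of a map on the unit sphere to `ℝ^(m+1)` minus the origin that is constant along
rays (with value `0` at the origin). Its derivatives at points of the sphere in directions tangent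
to the sphere are those of the original map. -/
def radialExt {m : ℕ} (Y : S m → E (m + 1)) (x : E (m + 1)) : E (m + 1) :=
  if h : x ≠ 0 then
    Y ⟨‖x‖⁻¹ • x, by
      rw [mem_sphere_zero_iff_norm, norm_smul, norm_inv, norm_norm,
        inv_mul_cancel₀ (norm_ne_zero_iff.mpr h)]⟩
  else 0

/-- `v` is tangent to the unit sphere at `p`. -/
def IsTangent {m : ℕ} (p : S m) (v : E (m + 1)) : Prop := ⟪(p : E (m + 1)), v⟫ = 0

/-- The differential of `Y` at the point `p` of the sphere. -/
def diff {m : ℕ} (Y : S m → E (m + 1)) (p : E (m + 1)) (v : E (m + 1)) : E (m + 1) :=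
  fderiv ℝ (radialExt Y) p v

/-- The slice sphere of radius `r`, parametrized by the unit sphere. -/
def slice (m : ℕ) (r : ℝ) (p : S m) : E (m + 1) := r • (p : E (m + 1))

/-- `Y` is a smooth embedding of the unit sphere (a smooth injective immersion; the sphere is
compact) with image in the region `{x | ‖x‖ ∈ I}`. -/
structure IsEmbeddedSphere {m : ℕ} (I : Set ℝ) (Y : S m → E (m + 1)) : Prop where
  smooth : ContMDiff (𝓡 m) 𝓘(ℝ, E (m + 1)) ∞ Y
  injective : Function.Injective Y
  immersion : ∀ p : S m, ∀ v, IsTangent p v → diff Y p v = 0 → v = 0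
  mem : ∀ p : S m, ‖Y p‖ ∈ I

/-- The metric induced on the unit sphere by `Y` from the warped product metric. -/
def firstForm {m : ℕ} (f : ℝ → ℝ) (Y : S m → E (m + 1)) (p u v : E (m + 1)) : ℝ :=
  metric f (radialExt Y p) (diff Y p u) (diff Y p v)

/-- `ν` is the outer unit normal of the star-shaped hypersurface `Y`: it is of unit length and
orthogonal to the hypersurface for the warped product metric, and its product with the radial
direction is positive. -/
structure IsOuterUnitNormal {m : ℕ} (f : ℝ → ℝ) (Y ν : S m → E (m + 1)) : Prop where
  unit : ∀ p : S m, metric f (Y p) (ν p) (ν p) = 1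
  normal : ∀ p : S m, ∀ v, IsTangent p v → metric f (Y p) (ν p) (diff Y p v) = 0
  outer : ∀ p : S m, 0 < metric f (Y p) (ν p) (Y p)

/-- The second fundamental form `h(u, v) = - (D_u dY(v)) · ν` of `Y` with respect to the normal `ν`,
pulled back to the unit sphere, where `D` is the Levi-Civita connection and `·` the metric of the
warped product. The sign makes `h` positive on slice spheres, with `ν` the outer normal. -/
def secondForm {m : ℕ} (f : ℝ → ℝ) (Y ν : S m → E (m + 1)) (p : S m) (u v : E (m + 1)) : ℝ :=
  -(metric f (Y p) (fderiv ℝ (fderiv ℝ (radialExt Y)) (p : E (m + 1)) u v) (ν p)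
    + christoffelFirst f (Y p) (diff Y p u) (diff Y p v) (ν p))

/-- Strict convexity: the second fundamental form for the outer normal is positive definite. -/
def IsConvex {m : ℕ} (f : ℝ → ℝ) (Y ν : S m → E (m + 1)) : Prop :=
  ∀ p : S m, ∀ v, IsTangent p v → v ≠ 0 → 0 < secondForm f Y ν p v v

/-- `Y` and `Z` are at distance less than `δ` in `C^k` on the unit sphere. -/
def CkClose {m : ℕ} (k : ℕ) (δ : ℝ) (Y Z : S m → E (m + 1)) : Prop :=
  ∀ j ≤ k, ∀ p : S m,
    ‖iteratedFDeriv ℝ j (fun x => radialExt Y x - radialExt Z x) (p : E (m + 1))‖ < δ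

/-! ### Scalar curvature of a Riemannian metric -/

/-- The `i`-th partial derivative of a function of `m` real variables. -/
def pd {m : ℕ} {F : Type*} [NormedAddCommGroup F] [NormedSpace ℝ F]
    (i : Fin m) (φ : E m → F) (x : E m) : F :=
  fderiv ℝ φ x (EuclideanSpace.single i 1)

/-- The Christoffel symbol `Γ^k_ij` of a metric `G = (G_ij)` in coordinates. -/
def christoffel {m : ℕ} (G : E m → Matrix (Fin m) (Fin m) ℝ) (k i j : Fin m) (x : E m) : ℝ :=
  (1 / 2) * ∑ l, (G x)⁻¹ k l *
    (pd i (fun y => G y j l) x + pd j (fun y => G y i l) x - pd l (fun y => G y i j) x)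

/-- The component `R^l_ijk` of the curvature tensor,
`(∇_i ∇_j - ∇_j ∇_i) ∂_k = ∑_l R^l_ijk ∂_l`. -/
def riemann {m : ℕ} (G : E m → Matrix (Fin m) (Fin m) ℝ) (l i j k : Fin m) (x : E m) : ℝ :=
  pd i (christoffel G l j k) x - pd j (christoffel G l i k) x
    + ∑ s, (christoffel G l i s x * christoffel G s j k x
      - christoffel G l j s x * christoffel G s i k x)

/-- The Ricci curvature `R_jk`, the trace of `X ↦ R(X, ∂_j) ∂_k`. -/
def ricci {m : ℕ} (G : E m → Matrix (Fin m) (Fin m) ℝ) (j k : Fin m) (x : E m) : ℝ :=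
  ∑ i, riemann G i i j k x

/-- The scalar curvature of a metric in coordinates. -/
def scalarCurvature {m : ℕ} (G : E m → Matrix (Fin m) (Fin m) ℝ) (x : E m) : ℝ :=
  ∑ j, ∑ k, (G x)⁻¹ j k * ricci G j k x

/-- `φ` is a smooth local parametrization of the unit sphere, defined on the open set `U`. -/
structure IsLocalParam {m : ℕ} (U : Set (E m)) (φ : E m → E (m + 1)) : Prop where
  isOpen : IsOpen U
  smooth : ContDiffOn ℝ ∞ φ U
  mem_sphere : ∀ x ∈ U, φ x ∈ Metric.sphere (0 : E (m + 1)) 1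
  injOn : Set.InjOn φ U
  immersion : ∀ x ∈ U, Function.Injective (fderiv ℝ φ x)

/-- The metric `γ` on the unit sphere (evaluated at a point and two tangent vectors) has constant
scalar curvature `c`: in all local coordinates, its scalar curvature is `c` at every point. -/
def HasConstantScalarCurvature (m : ℕ) (γ : E (m + 1) → E (m + 1) → E (m + 1) → ℝ) (c : ℝ) :
    Prop :=
  ∀ (U : Set (E m)) (φ : E m → E (m + 1)), IsLocalParam U φ → ∀ x ∈ U,
    scalarCurvature (fun y => Matrix.of fun i j => γ (φ y) (pd i φ y) (pd j φ y)) x = c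

end WarpedProduct

end

/-! The slice is perturbed by moving each point parallel to a fixed unit vector `e`: `Y p = r p +
W(r⟪e, p⟫) e`, where the shift depends only on the height `t = r⟪e, p⟫`. Such a map is smooth across
the poles as soon as `W` is smooth near `[-r, r]`, and `‖Y p‖` depends only on `t` and `w = W t`. In
Cartesian coordinates the ambient metric is `⟪u, v⟫ + b ⟪x, u⟫⟪x, v⟫` with `b = warp f ‖x‖`, so the
induced metric differs from that of the slice by a multiple of `⟪e, u⟫⟪e, v⟫`. With `q = W'`, the
isometry condition is therefore one scalar equation, `2q + q² + b (tq + w + wq)² = 0`.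

This is quadratic in `q`, and its root near zero is `w² κ(t, w)` with `κ` smooth near the axis `w =
0`. Hence isometry is the ODE `W' = W² κ(t, W)`, for which `W = 0` (the slice) is a solution.
Because the right side is quadratic in `W`, every small initial value `W r = ε` gives a solution on
a fixed interval around `[-r, r]` (`exists_small_solution`). Every derivative of `W` is a smooth
function of `(t, W t)` vanishing on the axis, so `C^k` closeness, embeddedness and strict convexity
are all open conditions near the axis, met by keeping the graph of `W` in a suitable neighbourhood
(`smallSet`, `goodDomain`).

The second fundamental forms are compared at the pole `e`. Multiplied by `f(r + ε)`, their
difference on unit tangent vectors vanishes at `ε = 0` and has derivative `r²` times the quantity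
assumed nonzero there, so it is nonzero for small `ε ≠ 0` (`eventually_hessNorm_pole_ne`). Roundness
of the image is excluded by comparing the pole with the points orthogonal to `e`. The scalar
curvature depends only on the induced metric, that of a Euclidean sphere of radius `r`, and is found
from the Gauss formula in coordinates. -/

noncomputable section

namespace WarpedProduct

open Set Metric

/-! ### Small solutions of the ODE on a fixed interval. -/

/-- Picard–Lindelöf, keeping track of the ball in which the solution stays. -/
theorem exists_hasDerivWithinAt_mem_closedBall {F : Type*} [NormedAddCommGroup F] [NormedSpace ℝ F]
    [CompleteSpace F] {v : ℝ → F → F} {tmin tmax : ℝ} {t₀ : Icc tmin tmax} {x₀ x : F}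
    {a r L K : NNReal} (hv : IsPicardLindelof v t₀ x₀ a r L K) (hx : x ∈ closedBall x₀ r) :
    ∃ α : ℝ → F, α t₀ = x ∧ (∀ t, α t ∈ closedBall x₀ a) ∧
      ∀ t ∈ Icc tmin tmax, HasDerivWithinAt α (v t (α t)) (Icc tmin tmax) t := by
  obtain ⟨α, hα⟩ := ODE.FunSpace.exists_isFixedPt_next hv hx
  refine ⟨α.compProj, by rw [ODE.FunSpace.compProj_val, ← hα, ODE.FunSpace.next_apply₀],
    fun t => α.compProj_mem_closedBall hv.mul_max_le, fun t ht ↦ ?_⟩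
  apply ODE.hasDerivWithinAt_picard_Icc t₀.2 hv.continuousOn_uncurry
    α.continuous_compProj.continuousOn (fun _ ht' ↦ α.compProj_mem_closedBall hv.mul_max_le)
    x ht |>.congr_of_mem _ ht
  intro t' ht'
  nth_rw 1 [← hα]
  rw [ODE.FunSpace.compProj_of_mem ht', ODE.FunSpace.next_apply]

/-- A compact box around `[-r, r] × {0}` inside a given open neighbourhood. -/
theorem exists_box_subset {U : Set (ℝ × ℝ)} (hU : IsOpen U) {r : ℝ} (hr : 0 < r)
    (h : ∀ t ∈ Icc (-r) r, (t, (0 : ℝ)) ∈ U) :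
    ∃ R > r, ∃ η > 0, Icc (-R) R ×ˢ closedBall (0 : ℝ) η ⊆ U := by
  have h0 : closedBall (0 : ℝ) r ×ˢ ({0} : Set ℝ) ⊆ U := by
    rintro ⟨t, w⟩ ⟨ht, hw⟩
    obtain rfl : w = 0 := hw
    rw [Real.closedBall_eq_Icc] at ht
    exact h t (by simpa using ht)
  obtain ⟨V, W, hV, hW, hrV, hW0, hVW⟩ :=
    generalized_tube_lemma (isCompact_closedBall (0 : ℝ) r) isCompact_singleton hU h0
  -- Thickening the compact segment inside `V` supplies the strict margin `R > r`.
  obtain ⟨d, hd, hdV⟩ := (isCompact_closedBall (0 : ℝ) r).exists_cthickening_subset_open hV hrV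
  rw [cthickening_closedBall hd.le hr.le] at hdV
  obtain ⟨η, hη, hηW⟩ := nhds_basis_closedBall.mem_iff.1 (hW.mem_nhds (hW0 rfl))
  refine ⟨d + r, by linarith, η, hη, fun p hp => hVW ⟨hdV ?_, hηW hp.2⟩⟩
  rw [Real.closedBall_eq_Icc]
  simpa using hp.1

/-- Small solutions of `W' = W² κ(t, W)` exist on a neighbourhood of `[-r, r]`. -/
theorem exists_small_solution {U : Set (ℝ × ℝ)} (hU : IsOpen U) {r : ℝ} (hr : 0 < r)
    (h : ∀ t ∈ Icc (-r) r, (t, (0 : ℝ)) ∈ U) {κ : ℝ × ℝ → ℝ} (hκ : ContDiffOn ℝ ∞ κ U) :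
    ∃ R > r, ∃ ε₀ > 0, ∀ ε, 0 < ε → ε < ε₀ → ∃ W : ℝ → ℝ, W r = ε ∧
      ContDiffOn ℝ ∞ W (Ioo (-R) R) ∧ ∀ t ∈ Ioo (-R) R, (t, W t) ∈ U ∧
        HasDerivAt W (W t ^ 2 * κ (t, W t)) t := by
  obtain ⟨R, hR, η, hη, hbox⟩ := exists_box_subset hU hr h
  have hR0 : 0 < R := hr.trans hR
  have hG : ContDiffOn ℝ ∞ (fun p : ℝ × ℝ => p.2 ^ 2 * κ p) U := by fun_prop
  have hGbox := hG.mono hbox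
  have hcpt : IsCompact (Icc (-R) R ×ˢ closedBall (0 : ℝ) η) :=
    isCompact_Icc.prod (isCompact_closedBall _ _)
  have hconv : Convex ℝ (Icc (-R) R ×ˢ closedBall (0 : ℝ) η) :=
    (convex_Icc _ _).prod (convex_closedBall _ _)
  obtain ⟨K, hK⟩ := hGbox.exists_lipschitzOnWith (by simp) hconv hcpt
  obtain ⟨M, hM⟩ := hcpt.exists_bound_of_continuousOn (hκ.mono hbox).continuousOn
  have hM0 : 0 ≤ M := (norm_nonneg _).trans
    (hM (0, 0) ⟨⟨by linarith, hR0.le⟩, mem_closedBall_self hη.le⟩)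
  -- The first bound keeps the ball of radius `2ε` inside the box. The second gives `M (2ε)² · 2R ≤
  -- ε`: the quadratic field moves the solution by at most `ε` over the whole interval. `M + 1`
  -- avoids dividing by zero when `M = 0`.
  refine ⟨R, hR, min (η / 2) (1 / (8 * (M + 1) * R)), by positivity, fun ε hε hε' => ?_⟩
  have hεη : 2 * ε ≤ η := by have := hε'.trans_le (min_le_left _ _); linarith
  have hεM : 8 * (M + 1) * R * ε ≤ 1 := by
    have := hε'.trans_le (min_le_right _ _)
    rw [lt_div_iff₀ (by positivity)] at this
    linarith
  let a : NNReal := ⟨2 * ε, by positivity⟩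
  let r₀ : NNReal := ⟨ε, hε.le⟩
  let L : NNReal := ⟨M * (2 * ε) ^ 2, by positivity⟩
  have hball : closedBall (0 : ℝ) (a : ℝ) ⊆ closedBall 0 η := closedBall_subset_closedBall hεη
  -- The ball is centred at the trivial solution `0`, not at the initial value `ε`, so a confined
  -- solution satisfies `|W| ≤ 2ε`.
  have hPL : IsPicardLindelof (fun t w => w ^ 2 * κ (t, w)) (tmin := -R) (tmax := R)
      ⟨r, by constructor <;> linarith⟩ (0 : ℝ) a r₀ L K := by
    refine ⟨fun t ht => ?_, fun x hx => ?_, fun t ht x hx => ?_, ?_⟩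
    · refine LipschitzOnWith.of_dist_le_mul fun x hx y hy => ?_
      have := hK.dist_le_mul (t, x) ⟨ht, hball hx⟩ (t, y) ⟨ht, hball hy⟩
      simpa [Prod.dist_eq] using this
    · exact hGbox.continuousOn.comp (f := fun t => (t, x)) (by fun_prop)
        fun t ht => ⟨ht, hball hx⟩
    · rw [norm_mul, norm_pow, mul_comm]
      refine mul_le_mul (hM _ ⟨ht, hball hx⟩) ?_ (by positivity) hM0
      exact pow_le_pow_left₀ (norm_nonneg _) (mem_closedBall_zero_iff.1 hx) 2
    · have : max (R - r) (r - -R) ≤ 2 * R := max_le (by linarith) (by linarith)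
      calc M * (2 * ε) ^ 2 * max (R - r) (r - -R) ≤ M * (2 * ε) ^ 2 * (2 * R) := by gcongr
        _ = 8 * M * R * ε * ε := by ring
        _ ≤ 1 * ε := by
          gcongr
          nlinarith [mul_pos hR0 hε]
        _ = 2 * ε - ε := by ring
  obtain ⟨W, hW, hWb, hWd⟩ := exists_hasDerivWithinAt_mem_closedBall hPL (x := ε)
    (mem_closedBall_zero_iff.2 (abs_of_pos hε).le)
  have hsm : ContDiffOn ℝ ∞ W (Icc (-R) R) :=
    ODE.contDiffOn_enat_Icc_of_hasDerivWithinAt (n := ⊤) (u := closedBall 0 η)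
      (f := fun t w => w ^ 2 * κ (t, w)) hGbox hWd
      fun t _ => hball (hWb t)
  refine ⟨W, hW, hsm.mono Ioo_subset_Icc_self, fun t ht =>
    ⟨hbox ⟨Ioo_subset_Icc_self ht, hball (hWb t)⟩, ?_⟩⟩
  exact (hWd t (Ioo_subset_Icc_self ht)).hasDerivAt (Icc_mem_nhds ht.1 ht.2)

/-! ### Higher derivatives of solutions as functions on the plane. -/

/-- The derivative along the vector field `(1, G)` on the plane. -/
def along (G H : ℝ × ℝ → ℝ) (p : ℝ × ℝ) : ℝ := fderiv ℝ H p (1, G p)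

theorem contDiffOn_along {U : Set (ℝ × ℝ)} (hU : IsOpen U) {G H : ℝ × ℝ → ℝ}
    (hG : ContDiffOn ℝ ∞ G U) (hH : ContDiffOn ℝ ∞ H U) : ContDiffOn ℝ ∞ (along G H) U :=
  (hH.fderiv_of_isOpen hU (by simp)).clm_apply (contDiffOn_const.prodMk hG)

theorem hasDerivAt_comp_along {U : Set (ℝ × ℝ)} (hU : IsOpen U) {G H : ℝ × ℝ → ℝ}
    (hH : ContDiffOn ℝ ∞ H U) {W : ℝ → ℝ} {t : ℝ} (ht : (t, W t) ∈ U)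
    (hW : HasDerivAt W (G (t, W t)) t) :
    HasDerivAt (fun s => H (s, W s)) (along G H (t, W t)) t := by
  have h := ((hH.contDiffAt (hU.mem_nhds ht)).differentiableAt (by simp)).hasFDerivAt
  exact h.comp_hasDerivAt t (f := fun s => (s, W s)) ((hasDerivAt_id t).prodMk hW)

theorem contDiffOn_iterate_along {U : Set (ℝ × ℝ)} (hU : IsOpen U) {G : ℝ × ℝ → ℝ}
    (hG : ContDiffOn ℝ ∞ G U) (j : ℕ) : ContDiffOn ℝ ∞ ((along G)^[j] Prod.snd) U := by
  induction j with
  | zero => exact contDiff_snd.contDiffOn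
  | succ j ih =>
    rw [Function.iterate_succ_apply']
    exact contDiffOn_along hU hG ih

/-- Differentiating the ODE repeatedly never brings in more data than the point `(t, W t)`. This
turns `C^k` smallness of `W` into a condition on where its graph lies. -/
theorem iteratedDeriv_eq_iterate_along {U : Set (ℝ × ℝ)} (hU : IsOpen U) {G : ℝ × ℝ → ℝ}
    (hG : ContDiffOn ℝ ∞ G U) {J : Set ℝ} (hJ : IsOpen J) {W : ℝ → ℝ}
    (hW : ∀ t ∈ J, (t, W t) ∈ U ∧ HasDerivAt W (G (t, W t)) t) (j : ℕ) :
    ∀ t ∈ J, iteratedDeriv j W t = (along G)^[j] Prod.snd (t, W t) := by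
  induction j with
  | zero => intro t _; simp
  | succ j ih =>
    intro t ht
    rw [iteratedDeriv_succ, Function.iterate_succ_apply']
    have : iteratedDeriv j W =ᶠ[nhds t] fun s => (along G)^[j] Prod.snd (s, W s) :=
      Filter.eventually_of_mem (hJ.mem_nhds ht) ih
    rw [this.deriv_eq]
    exact (hasDerivAt_comp_along hU (contDiffOn_iterate_along hU hG j) (hW t ht).1
      (hW t ht).2).deriv

/-- If `G` and `H` vanish along the axis `w = 0`, then so does the derivative of `H` along
`(1, G)`. -/
theorem along_apply_zero {U : Set (ℝ × ℝ)} (hU : IsOpen U) {G H : ℝ × ℝ → ℝ}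
    (hH : ContDiffOn ℝ ∞ H U) (hG0 : ∀ t, G (t, 0) = 0)
    (hH0 : ∀ t, (t, (0 : ℝ)) ∈ U → H (t, 0) = 0) {t : ℝ} (ht : (t, (0 : ℝ)) ∈ U) :
    along G H (t, 0) = 0 := by
  have h1 := hasDerivAt_comp_along (G := G) (W := fun _ => 0) hU hH ht
    (by simpa [hG0] using hasDerivAt_const t (0 : ℝ))
  have hnhds : ∀ᶠ s in nhds t, (s, (0 : ℝ)) ∈ U :=
    (Continuous.prodMk continuous_id continuous_const).continuousAt.eventually_mem (hU.mem_nhds ht)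
  have h2 : HasDerivAt (fun s => H (s, (0 : ℝ))) 0 t :=
    (hasDerivAt_const t (0 : ℝ)).congr_of_eventuallyEq (hnhds.mono fun s hs => hH0 s hs)
  exact h1.unique h2

/-- The axis is itself a trajectory, and along it the zero solution has zero derivatives; hence
`smallSet` contains the axis. -/
theorem iterate_along_apply_zero {U : Set (ℝ × ℝ)} (hU : IsOpen U) {G : ℝ × ℝ → ℝ}
    (hG : ContDiffOn ℝ ∞ G U) (hG0 : ∀ t, G (t, 0) = 0) (j : ℕ) :
    ∀ t, (t, (0 : ℝ)) ∈ U → (along G)^[j] Prod.snd (t, 0) = 0 := by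
  induction j with
  | zero => intro t _; rfl
  | succ j ih =>
    intro t ht
    rw [Function.iterate_succ_apply']
    exact along_apply_zero hU (contDiffOn_iterate_along hU hG j) hG0 ih ht

/-- The points where the first `k` derivatives of solutions of `W' = G(t, W)` are small. -/
def smallSet (G : ℝ × ℝ → ℝ) (U : Set (ℝ × ℝ)) (k : ℕ) (δ : ℝ) : Set (ℝ × ℝ) :=
  {p ∈ U | ∀ j ≤ k, |(along G)^[j] Prod.snd p| < δ}

theorem isOpen_smallSet {U : Set (ℝ × ℝ)} (hU : IsOpen U) {G : ℝ × ℝ → ℝ}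
    (hG : ContDiffOn ℝ ∞ G U) (k : ℕ) (δ : ℝ) : IsOpen (smallSet G U k δ) := by
  rw [isOpen_iff_mem_nhds]
  intro p hp
  refine (Filter.eventually_all_finite (Set.finite_Iic k)).2 (fun j hj => ?_) |>.mp
    ((hU.eventually_mem hp.1).mono fun q hq h => ⟨hq, h⟩)
  exact ((contDiffOn_iterate_along hU hG j).continuousOn.continuousAt
    (hU.mem_nhds hp.1)).abs.eventually_lt continuousAt_const (hp.2 j hj)

/-! ### Coordinate calculus and smoothness of the inverse matrix. -/

section PartialDerivatives

variable {m : ℕ} {F : Type*} [NormedAddCommGroup F] [NormedSpace ℝ F]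

theorem contDiffOn_pd {U : Set (E m)} (hU : IsOpen U) {φ : E m → F} (hφ : ContDiffOn ℝ ∞ φ U)
    (i : Fin m) : ContDiffOn ℝ ∞ (pd i φ) U :=
  (hφ.fderiv_of_isOpen hU (by simp)).clm_apply contDiffOn_const

theorem pd_congr {U : Set (E m)} (hU : IsOpen U) {φ ψ : E m → F} (h : EqOn φ ψ U) {x : E m}
    (hx : x ∈ U) (i : Fin m) : pd i φ x = pd i ψ x := by
  rw [pd, pd, (h.eventuallyEq_of_mem (hU.mem_nhds hx)).fderiv_eq]

theorem pd_comm {U : Set (E m)} (hU : IsOpen U) {φ : E m → F} (hφ : ContDiffOn ℝ ∞ φ U)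
    {x : E m} (hx : x ∈ U) (i j : Fin m) : pd i (pd j φ) x = pd j (pd i φ) x := by
  have hc := hφ.contDiffAt (hU.mem_nhds hx)
  have hd : DifferentiableAt ℝ (fderiv ℝ φ) x :=
    (hc.fderiv_right (m := 1) (by norm_cast)).differentiableAt (by simp)
  have key (i j : Fin m) : pd i (pd j φ) x = fderiv ℝ (fderiv ℝ φ) x
      (EuclideanSpace.single i 1) (EuclideanSpace.single j 1) := by
    change fderiv ℝ (fun y => fderiv ℝ φ y (EuclideanSpace.single j 1)) x _ = _
    rw [fderiv_clm_apply hd (differentiableAt_const _)]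
    simp
  rw [key, key]
  exact (hc.isSymmSndFDerivAt (by simp; norm_cast)) _ _

theorem pd_inner {V : Type*} [NormedAddCommGroup V] [InnerProductSpace ℝ V] {X Z : E m → V}
    {x : E m} (hX : DifferentiableAt ℝ X x) (hZ : DifferentiableAt ℝ Z x) (i : Fin m) :
    pd i (fun y => ⟪X y, Z y⟫) x = ⟪pd i X x, Z x⟫ + ⟪X x, pd i Z x⟫ := by
  rw [pd, fderiv_inner_apply ℝ hX hZ, add_comm]
  rfl

theorem pd_smul {c : E m → ℝ} {X : E m → F} {x : E m} (hc : DifferentiableAt ℝ c x)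
    (hX : DifferentiableAt ℝ X x) (i : Fin m) :
    pd i (fun y => c y • X y) x = pd i c x • X x + c x • pd i X x := by
  simp only [pd]
  rw [fderiv_fun_smul hc hX, add_comm]
  simp

theorem pd_add {X Z : E m → F} {x : E m} (hX : DifferentiableAt ℝ X x)
    (hZ : DifferentiableAt ℝ Z x) (i : Fin m) :
    pd i (fun y => X y + Z y) x = pd i X x + pd i Z x := by
  simp only [pd]
  rw [fderiv_fun_add hX hZ]
  simp

theorem pd_sum {ι : Type*} (s : Finset ι) {X : ι → E m → F} {x : E m}
    (hX : ∀ l ∈ s, DifferentiableAt ℝ (X l) x) (i : Fin m) :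
    pd i (fun y => ∑ l ∈ s, X l y) x = ∑ l ∈ s, pd i (X l) x := by
  simp only [pd]
  rw [fderiv_fun_sum hX]
  simp

end PartialDerivatives

section MatrixSmoothness

variable {m n : ℕ} {U : Set (E m)} {G : E m → Matrix (Fin n) (Fin n) ℝ}

theorem contDiffOn_det (hG : ∀ i j, ContDiffOn ℝ ∞ (fun y => G y i j) U) :
    ContDiffOn ℝ ∞ (fun y => (G y).det) U := by
  simp only [Matrix.det_apply]
  exact ContDiffOn.sum fun σ _ => (contDiffOn_prod fun i _ => hG _ _).const_smul _

theorem contDiffOn_inv_apply (hG : ∀ i j, ContDiffOn ℝ ∞ (fun y => G y i j) U)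
    (hdet : ∀ y ∈ U, (G y).det ≠ 0) (i j : Fin n) :
    ContDiffOn ℝ ∞ (fun y => (G y)⁻¹ i j) U := by
  simp only [Matrix.inv_def, Ring.inverse_eq_inv', Matrix.smul_apply, smul_eq_mul,
    Matrix.adjugate_apply]
  refine ((contDiffOn_det hG).inv hdet).mul (contDiffOn_det fun a b => ?_)
  simp only [Matrix.updateRow_apply]
  split_ifs
  · exact contDiffOn_const
  · exact hG a b

end MatrixSmoothness

/-- A vector orthogonal to `m` independent vectors and to a common normal of them in `ℝ^(m+1)`
vanishes. -/
theorem eq_zero_of_inner_eq_zero {m : ℕ} {X : Fin m → E (m + 1)} (hX : LinearIndependent ℝ X)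
    {n z : E (m + 1)} (hn : n ≠ 0) (hnX : ∀ s, ⟪X s, n⟫ = 0) (hz : ∀ s, ⟪X s, z⟫ = 0)
    (hzn : ⟪n, z⟫ = 0) : z = 0 := by
  set T := Submodule.span ℝ (Set.range X)
  have hT : Module.finrank ℝ T = m := by simpa using finrank_span_eq_card hX
  -- The orthogonal complement is a line, so `n` spans it and `z` is a multiple of `n`.
  have hT' : Module.finrank ℝ Tᗮ = 1 := by
    have := T.finrank_add_finrank_orthogonal
    rw [hT, finrank_euclideanSpace, Fintype.card_fin] at this
    omega
  have mem (w : E (m + 1)) (hw : ∀ s, ⟪X s, w⟫ = 0) : w ∈ Tᗮ := by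
    rw [Submodule.mem_orthogonal]
    intro u hu
    induction hu using Submodule.span_induction with
    | mem x hx => obtain ⟨s, rfl⟩ := hx; exact hw s
    | zero => simp
    | add x y _ _ hx hy => rw [inner_add_left, hx, hy, add_zero]
    | smul a x _ hx => rw [inner_smul_left, hx, mul_zero]
  obtain ⟨c, hc⟩ := (finrank_eq_one_iff_of_nonzero' (⟨n, mem n hnX⟩ : Tᗮ)
    (by simpa using hn)).1 hT' ⟨z, mem z hz⟩
  have hc' : c • n = z := congrArg Subtype.val hc
  rw [← hc', inner_smul_right] at hzn
  rcases mul_eq_zero.1 hzn with h | h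
  · rw [← hc', h, zero_smul]
  · exact absurd (inner_self_eq_zero.1 h) hn

/-! ### Curvature of the round sphere in local coordinates. -/

section SphereCurvature

variable {m : ℕ} {U : Set (E m)} {φ : E m → E (m + 1)} {G : E m → Matrix (Fin m) (Fin m) ℝ} {r : ℝ}

theorem IsLocalParam.linearIndependent (h : IsLocalParam U φ) {x : E m} (hx : x ∈ U) :
    LinearIndependent ℝ fun i => pd i φ x := by
  have := (EuclideanSpace.basisFun (Fin m) ℝ).toBasis.linearIndependent.map'
    (fderiv ℝ φ x).toLinearMap (LinearMap.ker_eq_bot.2 (h.immersion x hx))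
  have heq : (fun i => pd i φ x) = (fderiv ℝ φ x).toLinearMap ∘
      (EuclideanSpace.basisFun (Fin m) ℝ).toBasis := by
    ext i
    simp [pd]
  rw [heq]
  exact this

theorem IsLocalParam.inner_self (h : IsLocalParam U φ) {x : E m} (hx : x ∈ U) :
    ⟪φ x, φ x⟫ = 1 := by
  have := h.mem_sphere x hx
  rw [mem_sphere_zero_iff_norm] at this
  rw [real_inner_self_eq_norm_sq, this, one_pow]

theorem IsLocalParam.differentiableAt (h : IsLocalParam U φ) {x : E m} (hx : x ∈ U) :
    DifferentiableAt ℝ φ x :=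
  (h.smooth.contDiffAt (h.isOpen.mem_nhds hx)).differentiableAt (by simp)

theorem IsLocalParam.differentiableAt_pd (h : IsLocalParam U φ) {x : E m} (hx : x ∈ U)
    (i : Fin m) : DifferentiableAt ℝ (pd i φ) x :=
  ((contDiffOn_pd h.isOpen h.smooth i).contDiffAt (h.isOpen.mem_nhds hx)).differentiableAt
    (by simp)

/-- Differentiate `⟪φ, φ⟫ = 1`; differentiating once more gives `inner_pd_pd`, the second
fundamental form of the unit sphere. -/
theorem IsLocalParam.inner_pd (h : IsLocalParam U φ) {x : E m} (hx : x ∈ U) (i : Fin m) :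
    ⟪pd i φ x, φ x⟫ = 0 := by
  have h1 := pd_congr h.isOpen (fun y hy => h.inner_self hy) hx i
  rw [pd_inner (h.differentiableAt hx) (h.differentiableAt hx),
    real_inner_comm (pd i φ x) (φ x)] at h1
  simp only [pd, fderiv_fun_const, Pi.zero_apply, _root_.zero_apply] at h1 ⊢
  linarith

theorem IsLocalParam.inner_pd_pd (h : IsLocalParam U φ) {x : E m} (hx : x ∈ U) (i j : Fin m) :
    ⟪pd i (pd j φ) x, φ x⟫ = -⟪pd i φ x, pd j φ x⟫ := by
  have h1 := pd_congr h.isOpen (fun y hy => h.inner_pd hy j) hx i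
  rw [pd_inner (h.differentiableAt_pd hx j) (h.differentiableAt hx),
    real_inner_comm (pd i φ x) (pd j φ x)] at h1
  simp only [pd, fderiv_fun_const, Pi.zero_apply, _root_.zero_apply] at h1 ⊢
  linarith

/-- `G` is the metric of the sphere of radius `r` in the coordinates `φ`. -/
def IsSphereMetric (U : Set (E m)) (φ : E m → E (m + 1)) (r : ℝ)
    (G : E m → Matrix (Fin m) (Fin m) ℝ) : Prop :=
  ∀ y ∈ U, ∀ i j, G y i j = r ^ 2 * ⟪pd i φ y, pd j φ y⟫

theorem IsSphereMetric.contDiffOn (hG : IsSphereMetric U φ r G) (h : IsLocalParam U φ)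
    (i j : Fin m) : ContDiffOn ℝ ∞ (fun y => G y i j) U :=
  (contDiffOn_const.mul ((contDiffOn_pd h.isOpen h.smooth i).inner ℝ
    (contDiffOn_pd h.isOpen h.smooth j))).congr fun y hy => hG y hy i j

theorem IsSphereMetric.pd_apply (hG : IsSphereMetric U φ r G) (h : IsLocalParam U φ) {x : E m}
    (hx : x ∈ U) (s i j : Fin m) :
    pd s (fun y => G y i j) x =
      r ^ 2 * (⟪pd s (pd i φ) x, pd j φ x⟫ + ⟪pd i φ x, pd s (pd j φ) x⟫) := by
  rw [pd_congr h.isOpen (fun y hy => hG y hy i j) hx s,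
    ← pd_inner (h.differentiableAt_pd hx i) (h.differentiableAt_pd hx j)]
  rw [pd, fderiv_const_mul ((h.differentiableAt_pd hx i).inner ℝ (h.differentiableAt_pd hx j))]
  rfl

theorem IsSphereMetric.mulVec_apply (hG : IsSphereMetric U φ r G) {x : E m}
    (hx : x ∈ U) (c : Fin m → ℝ) (q : Fin m) :
    (G x).mulVec c q = r ^ 2 * ⟪pd q φ x, ∑ l, c l • pd l φ x⟫ := by
  simp only [Matrix.mulVec, dotProduct, inner_sum, inner_smul_right, Finset.mul_sum, hG x hx]
  exact Finset.sum_congr rfl fun l _ => by ring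

/-- A kernel vector of the Gram matrix gives a tangent combination orthogonal to every coordinate
vector and to `φ x`, hence zero; independence kills its coefficients. -/
theorem IsSphereMetric.isUnit_det (hG : IsSphereMetric U φ r G) (h : IsLocalParam U φ)
    (hr : r ≠ 0) {x : E m} (hx : x ∈ U) : IsUnit (G x).det := by
  rw [← Matrix.isUnit_iff_isUnit_det, ← Matrix.mulVec_injective_iff_isUnit,
    ← Matrix.coe_mulVecLin, ← LinearMap.ker_eq_bot, LinearMap.ker_eq_bot']
  intro c hc
  have h0 : ∀ q, ⟪pd q φ x, ∑ l, c l • pd l φ x⟫ = 0 := fun q => by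
    have := congrFun hc q
    rw [Matrix.mulVecLin_apply, hG.mulVec_apply hx] at this
    simpa [hr] using this
  have h1 := eq_zero_of_inner_eq_zero (h.linearIndependent hx)
    (by intro h0; have := h.inner_self hx; simp [h0] at this) (h.inner_pd hx) h0 (by
      rw [inner_sum]
      exact Finset.sum_eq_zero fun l _ => by
        rw [inner_smul_right, real_inner_comm, h.inner_pd hx, mul_zero])
  exact funext (Fintype.linearIndependent_iff.1 (h.linearIndependent hx) c h1)

theorem IsSphereMetric.contDiffOn_christoffel (hG : IsSphereMetric U φ r G)
    (h : IsLocalParam U φ) (hr : r ≠ 0) (k i j : Fin m) :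
    ContDiffOn ℝ ∞ (christoffel G k i j) U := by
  unfold christoffel
  refine contDiffOn_const.mul (ContDiffOn.sum fun l _ => ?_)
  have hd (s a b : Fin m) := contDiffOn_pd h.isOpen (hG.contDiffOn h a b) s
  exact (contDiffOn_inv_apply (hG.contDiffOn h) (fun y hy => (hG.isUnit_det h hr hy).ne_zero)
    k l).mul (((hd _ _ _).add (hd _ _ _)).sub (hd _ _ _))

/-- The Gauss formula for the sphere. -/
theorem IsSphereMetric.gauss_formula (hG : IsSphereMetric U φ r G) (h : IsLocalParam U φ)
    (hr : r ≠ 0) {x : E m} (hx : x ∈ U) (i j : Fin m) :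
    ∑ l, christoffel G l i j x • pd l φ x
      = pd i (pd j φ) x
        + ⟪pd i φ x, pd j φ x⟫ • φ x := by
  rw [← sub_eq_zero]
  refine eq_zero_of_inner_eq_zero (h.linearIndependent hx)
    (by intro h0; have := h.inner_self hx; simp [h0] at this) (h.inner_pd hx) (fun q => ?_) ?_
  -- Tangential components: lowering the index leaves the Koszul combination of derivatives of `G`,
  -- in which all second derivatives of `φ` cancel except `⟪∂_i ∂_j φ, ∂_q φ⟫`.
  · have h1 := hG.mulVec_apply hx (fun l => christoffel G l i j x) q
    have h2 : (fun l => christoffel G l i j x) = (G x)⁻¹.mulVec (fun l => (1 / 2) *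
        (pd i (fun y => G y j l) x + pd j (fun y => G y i l) x
          - pd l (fun y => G y i j) x)) := by
      ext l
      simp only [christoffel, Matrix.mulVec, dotProduct, Finset.mul_sum]
      exact Finset.sum_congr rfl fun s _ => by ring
    rw [h2, Matrix.mulVec_mulVec, Matrix.mul_nonsing_inv _ (hG.isUnit_det h hr hx),
      Matrix.one_mulVec, hG.pd_apply h hx, hG.pd_apply h hx, hG.pd_apply h hx,
      pd_comm h.isOpen h.smooth hx j i, pd_comm h.isOpen h.smooth hx q i,
      pd_comm h.isOpen h.smooth hx q j,
      real_inner_comm (pd q φ x) (pd i (pd j φ) x),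
      real_inner_comm (pd j φ x) (pd i (pd q φ) x)] at h1
    rw [inner_sub_right, inner_add_right, inner_smul_right, h.inner_pd hx q]
    have : r ^ 2 ≠ 0 := pow_ne_zero 2 hr
    apply mul_left_cancel₀ this
    rw [mul_sub, ← h1]
    ring
  · rw [inner_sub_right, inner_add_right, inner_smul_right, h.inner_self hx,
      real_inner_comm (pd i (pd j φ) x), h.inner_pd_pd hx, inner_sum]
    rw [Finset.sum_eq_zero fun l _ => by
        rw [inner_smul_right, real_inner_comm, h.inner_pd hx, mul_zero]]
    ring

/-- The Gauss equation for the sphere, contracted with the coordinate vectors. -/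
theorem IsSphereMetric.sum_riemann_smul (hG : IsSphereMetric U φ r G) (h : IsLocalParam U φ)
    (hr : r ≠ 0) {x : E m} (hx : x ∈ U) (i j k : Fin m) :
    ∃ c : ℝ, ∑ l, riemann G l i j k x • pd l φ x
      = ⟪pd j φ x, pd k φ x⟫ • pd i φ x - ⟪pd i φ x, pd k φ x⟫ • pd j φ x + c • φ x := by
  have hΓ (a b c : Fin m) : DifferentiableAt ℝ (christoffel G a b c) x :=
    ((hG.contDiffOn_christoffel h hr a b c).contDiffAt (h.isOpen.mem_nhds hx)).differentiableAt
      (by simp)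
  have hX (a b : Fin m) : DifferentiableAt ℝ (pd a (pd b φ)) x :=
    ((contDiffOn_pd h.isOpen (contDiffOn_pd h.isOpen h.smooth b) a).contDiffAt
      (h.isOpen.mem_nhds hx)).differentiableAt (by simp)
  have hg (a b : Fin m) : DifferentiableAt ℝ (fun y => ⟪pd a φ y, pd b φ y⟫) x :=
    (h.differentiableAt_pd hx a).inner ℝ (h.differentiableAt_pd hx b)
  -- the derivative of the Gauss formula
  have key (i j k : Fin m) : ∑ l, pd i (christoffel G l j k) x • pd l φ x
      = pd i (pd j (pd k φ)) x + pd i (fun y => ⟪pd j φ y, pd k φ y⟫) x • φ x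
        + ⟪pd j φ x, pd k φ x⟫ • pd i φ x
        - ∑ l, christoffel G l j k x • pd i (pd l φ) x := by
    have h1 := pd_congr h.isOpen (fun y hy => hG.gauss_formula h hr hy j k) hx i
    rw [pd_sum _ (fun l _ => (hΓ _ _ _).fun_smul (h.differentiableAt_pd hx l)),
      pd_add (hX _ _) ((hg _ _).fun_smul (h.differentiableAt hx)),
      pd_smul (hg _ _) (h.differentiableAt hx)] at h1
    rw [Finset.sum_congr rfl fun l _ => pd_smul (hΓ l j k) (h.differentiableAt_pd hx l) i,
      Finset.sum_add_distrib] at h1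
    rw [eq_sub_iff_add_eq, h1]
    abel
  -- the quadratic terms
  have quad (i j k : Fin m) : ∑ l, christoffel G l j k x • pd i (pd l φ) x
      = ∑ l, (∑ s, christoffel G l i s x * christoffel G s j k x) • pd l φ x
        - (∑ s, christoffel G s j k x * ⟪pd i φ x, pd s φ x⟫) • φ x := by
    have h2 (s : Fin m) : pd i (pd s φ) x
        = ∑ l, christoffel G l i s x • pd l φ x - ⟪pd i φ x, pd s φ x⟫ • φ x := by
      rw [hG.gauss_formula h hr hx i s, add_sub_cancel_right]
    simp only [h2, smul_sub, Finset.sum_sub_distrib, Finset.smul_sum, smul_smul, Finset.sum_smul]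
    congr 1
    rw [Finset.sum_comm]
    exact Finset.sum_congr rfl fun l _ => Finset.sum_congr rfl fun s _ => by rw [mul_comm]
  have hsymm : pd i (pd j (pd k φ)) x = pd j (pd i (pd k φ)) x :=
    pd_comm h.isOpen (contDiffOn_pd h.isOpen h.smooth k) hx i j
  have expand : ∑ l, riemann G l i j k x • pd l φ x
      = ∑ l, pd i (christoffel G l j k) x • pd l φ x - ∑ l, pd j (christoffel G l i k) x • pd l φ x
        + (∑ l, (∑ s, christoffel G l i s x * christoffel G s j k x) • pd l φ x
          - ∑ l, (∑ s, christoffel G l j s x * christoffel G s i k x) • pd l φ x) := by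
    simp only [riemann, add_smul, sub_smul, Finset.sum_sub_distrib, Finset.sum_add_distrib]
  have regroup (a b c d A B : E (m + 1)) (p q s t : ℝ) :
      a + p • b + c - (A - s • b) - (a + q • b + d - (B - t • b)) + (A - B)
        = c - d + (p - q + s - t) • b := by
    module
  rw [expand, key i j k, key j i k, quad i j k, quad j i k, hsymm]
  exact ⟨_, regroup ..⟩

/-- Pairing the Gauss equation with `φ x` shows that its unspecified normal part is zero, and
independence of the coordinate vectors then allows comparing coefficients. -/
theorem IsSphereMetric.riemann_eq (hG : IsSphereMetric U φ r G) (h : IsLocalParam U φ)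
    (hr : r ≠ 0) {x : E m} (hx : x ∈ U) (l i j k : Fin m) :
    riemann G l i j k x = ⟪pd j φ x, pd k φ x⟫ * (if l = i then 1 else 0)
      - ⟪pd i φ x, pd k φ x⟫ * (if l = j then 1 else 0) := by
  obtain ⟨c, hc⟩ := hG.sum_riemann_smul h hr hx i j k
  have hc0 : c = 0 := by
    have h1 := congrArg (fun v => ⟪v, φ x⟫) hc
    simp only [sum_inner, inner_add_left, inner_sub_left, inner_smul_left, h.inner_pd hx,
      h.inner_self hx, mul_zero, Finset.sum_const_zero] at h1
    simpa using h1.symm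
  rw [hc0, zero_smul, add_zero] at hc
  rw [← sub_eq_zero]
  refine Fintype.linearIndependent_iff.1 (h.linearIndependent hx)
    (fun l => riemann G l i j k x - (⟪pd j φ x, pd k φ x⟫ * (if l = i then 1 else 0)
      - ⟪pd i φ x, pd k φ x⟫ * (if l = j then 1 else 0))) ?_ l
  simp only [sub_smul, Finset.sum_sub_distrib, hc]
  simp

/-- The sphere of radius `r` has scalar curvature `m (m - 1) / r²`. -/
theorem hasConstantScalarCurvature_of_eq {γ : E (m + 1) → E (m + 1) → E (m + 1) → ℝ} (hr : r ≠ 0)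
    (hγ : ∀ p : S m, ∀ u v, IsTangent p u → IsTangent p v → γ p u v = r ^ 2 * ⟪u, v⟫) :
    HasConstantScalarCurvature m γ ((m : ℝ) * (m - 1) / r ^ 2) := by
  intro U φ h x hx
  set G : E m → Matrix (Fin m) (Fin m) ℝ :=
    fun y => Matrix.of fun i j => γ (φ y) (pd i φ y) (pd j φ y)
  have hG : IsSphereMetric U φ r G := fun y hy i j =>
    hγ ⟨φ y, h.mem_sphere y hy⟩ _ _ (by rw [IsTangent, real_inner_comm]; exact h.inner_pd hy i)
      (by rw [IsTangent, real_inner_comm]; exact h.inner_pd hy j)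
  -- The contraction gives `m` from `δ_ii` and subtracts one, so the metric is Einstein.
  have hric (j k : Fin m) : ricci G j k x = (m - 1) / r ^ 2 * G x k j := by
    simp only [ricci, hG.riemann_eq h hr hx, Finset.sum_sub_distrib, hG x hx]
    simp only [if_true, mul_one, Finset.sum_const, Finset.card_univ, Fintype.card_fin, nsmul_eq_mul,
      mul_ite, mul_zero, Finset.sum_ite_eq', Finset.mem_univ]
    rw [real_inner_comm (pd j φ x)]
    field_simp
  have htr : ∑ j, ∑ k, (G x)⁻¹ j k * G x k j = m := by
    have := congrArg Matrix.trace (Matrix.nonsing_inv_mul _ (hG.isUnit_det h hr hx))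
    simpa [Matrix.trace, Matrix.mul_apply] using this
  calc scalarCurvature G x
      = (m - 1) / r ^ 2 * ∑ j, ∑ k, (G x)⁻¹ j k * G x k j := by
        simp only [scalarCurvature, hric, Finset.mul_sum]
        exact Finset.sum_congr rfl fun j _ => Finset.sum_congr rfl fun k _ => by ring
    _ = m * (m - 1) / r ^ 2 := by rw [htr]; ring

end SphereCurvature

/-! ### Derivatives of maps made constant along rays. -/

section Normalization

variable {V : Type*} [NormedAddCommGroup V] [InnerProductSpace ℝ V]

theorem hasFDerivAt_norm {x : V} (hx : x ≠ 0) :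
    HasFDerivAt (fun y : V => ‖y‖) (‖x‖⁻¹ • innerSL ℝ x) x := by
  have h1 := (hasStrictFDerivAt_norm_sq x).hasFDerivAt.sqrt (by simpa using hx)
  simp only [Real.sqrt_sq (norm_nonneg _)] at h1
  refine h1.congr_fderiv ?_
  ext z
  simp
  ring

theorem contDiffAt_normalize {x : V} (hx : x ≠ 0) :
    ContDiffAt ℝ ∞ (fun y : V => ‖y‖⁻¹ • y) x :=
  ((contDiffAt_norm ℝ hx).inv (norm_ne_zero_iff.2 hx)).smul contDiffAt_id

/-- The derivative of `x ↦ x / ‖x‖` at `x ≠ 0`. -/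
def normalizeDeriv (x v : V) : V := ‖x‖⁻¹ • v - (‖x‖⁻¹ ^ 3 * ⟪x, v⟫) • x

theorem fderiv_normalize {x : V} (hx : x ≠ 0) (v : V) :
    fderiv ℝ (fun y : V => ‖y‖⁻¹ • y) x v = normalizeDeriv x v := by
  have hx' : ‖x‖ ≠ 0 := norm_ne_zero_iff.2 hx
  have h : HasFDerivAt (fun y : V => ‖y‖⁻¹ • y) _ x :=
    ((hasDerivAt_inv hx').comp_hasFDerivAt x (hasFDerivAt_norm hx)).smul (hasFDerivAt_id x)
  rw [h.fderiv]
  simp only [normalizeDeriv, Function.comp_apply, _root_.add_apply, _root_.smul_apply,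
    ContinuousLinearMap.id_apply, ContinuousLinearMap.smulRight_apply, innerSL_apply_apply,
    smul_eq_mul, sub_eq_add_neg, ← neg_smul]
  congr 2
  field_simp

theorem normalizeDeriv_of_inner_eq_zero {p v : V} (hp : ‖p‖ = 1) (hv : ⟪p, v⟫ = 0) :
    normalizeDeriv p v = v := by
  simp [normalizeDeriv, hp, hv]

theorem hasDerivAt_line (p u : V) (s : ℝ) : HasDerivAt (fun s : ℝ => p + s • u) u s := by
  simpa using ((hasDerivAt_id s).smul_const u).const_add p

/-- In tangent directions `‖·‖` is stationary to first order, so only the derivative of `⟪x, v⟫` in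
the radial term survives. -/
theorem hasDerivAt_normalizeDeriv_line {p u v : V} (hp : ‖p‖ = 1) (hu : ⟪p, u⟫ = 0)
    (hv : ⟪p, v⟫ = 0) :
    HasDerivAt (fun s : ℝ => normalizeDeriv (p + s • u) v) (-⟪u, v⟫ • p) 0 := by
  have hp0 : p ≠ 0 := by rw [← norm_ne_zero_iff, hp]; exact one_ne_zero
  have h0 : p + (0 : ℝ) • u = p := by simp
  have hline := hasDerivAt_line p u 0
  have hn : HasDerivAt (fun s : ℝ => ‖p + s • u‖) 0 0 := by
    have : HasDerivAt (fun s : ℝ => ‖p + s • u‖) _ 0 :=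
      (hasFDerivAt_norm (x := p + (0 : ℝ) • u) (by rwa [h0])).comp_hasDerivAt 0 hline
    exact this.congr_deriv (by simp [hu])
  have hi : HasDerivAt (fun s : ℝ => ‖p + s • u‖⁻¹) 0 0 :=
    (hn.fun_inv (by simp [hp])).congr_deriv (by simp)
  have hin : HasDerivAt (fun s : ℝ => ⟪p + s • u, v⟫) ⟪u, v⟫ 0 :=
    (hline.inner ℝ (hasDerivAt_const (0 : ℝ) v)).congr_deriv (by simp)
  have h := (hi.smul_const v).sub (((hi.pow 3).mul hin).smul hline)
  refine h.congr_deriv ?_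
  simp [hp, hv]

theorem fderiv_comp_normalize {F : V → V} {p v : V} (hp : ‖p‖ = 1)
    (hF : DifferentiableAt ℝ F p) (hv : ⟪p, v⟫ = 0) :
    fderiv ℝ (fun y => F (‖y‖⁻¹ • y)) p v = fderiv ℝ F p v := by
  have hp0 : p ≠ 0 := by rw [← norm_ne_zero_iff, hp]; exact one_ne_zero
  have hpp : ‖p‖⁻¹ • p = p := by simp [hp]
  rw [fderiv_fun_comp p (by rwa [hpp]) ((contDiffAt_normalize hp0).differentiableAt (by simp)),
    ContinuousLinearMap.comp_apply, fderiv_normalize hp0, normalizeDeriv_of_inner_eq_zero hp hv,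
    hpp]

theorem contDiffAt_comp_normalize {F : V → V} {p : V} (hp : ‖p‖ = 1) (hF : ContDiffAt ℝ ∞ F p) :
    ContDiffAt ℝ ∞ (fun y => F (‖y‖⁻¹ • y)) p := by
  have hp0 : p ≠ 0 := by rw [← norm_ne_zero_iff, hp]; exact one_ne_zero
  have hpp : ‖p‖⁻¹ • p = p := by simp [hp]
  exact ContDiffAt.comp p (by rwa [hpp]) (contDiffAt_normalize hp0)

/-- The correction term comes from the curvature of the unit sphere. Both sides are the derivative
at `s = 0` of the first differential along the line `p + s u`, computed directly and by the chain
rule. -/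
theorem fderiv_fderiv_comp_normalize {F : V → V} {p u v : V} (hp : ‖p‖ = 1)
    (hF : ContDiffAt ℝ ∞ F p) (hu : ⟪p, u⟫ = 0) (hv : ⟪p, v⟫ = 0) :
    fderiv ℝ (fderiv ℝ fun y => F (‖y‖⁻¹ • y)) p u v
      = fderiv ℝ (fderiv ℝ F) p u v - ⟪u, v⟫ • fderiv ℝ F p p := by
  have hp0 : p ≠ 0 := by rw [← norm_ne_zero_iff, hp]; exact one_ne_zero
  have hpp : ‖p‖⁻¹ • p = p := by simp [hp]
  have h0 : p + (0 : ℝ) • u = p := by simp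
  have hline := hasDerivAt_line p u 0
  have hdR : DifferentiableAt ℝ (fderiv ℝ fun y => F (‖y‖⁻¹ • y)) p :=
    ((contDiffAt_comp_normalize hp hF).fderiv_right (m := 1) (by norm_cast)).differentiableAt
      (by simp)
  have hdF : DifferentiableAt ℝ (fderiv ℝ F) p :=
    (hF.fderiv_right (m := 1) (by norm_cast)).differentiableAt (by simp)
  have hN := (contDiffAt_normalize hp0).differentiableAt (by simp)
  have h1 : HasDerivAt (fun s : ℝ => fderiv ℝ (fun y => F (‖y‖⁻¹ • y)) (p + s • u) v)
      (fderiv ℝ (fderiv ℝ fun y => F (‖y‖⁻¹ • y)) p u v) 0 := by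
    have h : HasDerivAt (fun s : ℝ => fderiv ℝ (fun y => F (‖y‖⁻¹ • y)) (p + s • u)) _ 0 :=
      hdR.hasFDerivAt.comp_hasDerivAt_of_eq 0 hline h0.symm
    exact (h.clm_apply (hasDerivAt_const (0 : ℝ) v)).congr_deriv (by simp)
  have hc : HasDerivAt (fun s : ℝ => ‖p + s • u‖⁻¹ • (p + s • u)) u 0 := by
    have h : HasDerivAt (fun s : ℝ => ‖p + s • u‖⁻¹ • (p + s • u)) _ 0 :=
      hN.hasFDerivAt.comp_hasDerivAt_of_eq 0 hline h0.symm
    exact h.congr_deriv (by rw [fderiv_normalize hp0, normalizeDeriv_of_inner_eq_zero hp hu])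
  have h2 : HasDerivAt (fun s : ℝ => fderiv ℝ F (‖p + s • u‖⁻¹ • (p + s • u))
      (normalizeDeriv (p + s • u) v))
      (fderiv ℝ (fderiv ℝ F) p u v - ⟪u, v⟫ • fderiv ℝ F p p) 0 := by
    have h : HasDerivAt (fun s : ℝ => fderiv ℝ F (‖p + s • u‖⁻¹ • (p + s • u))) _ 0 :=
      hdF.hasFDerivAt.comp_hasDerivAt_of_eq 0 hc (by rw [h0, hpp])
    refine (h.clm_apply (hasDerivAt_normalizeDeriv_line hp hu hv)).congr_deriv ?_
    rw [h0, hpp, normalizeDeriv_of_inner_eq_zero hp hv, map_smul, neg_smul, sub_eq_add_neg]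
  refine h1.unique (h2.congr_of_eventuallyEq ?_)
  have hev : ∀ᶠ x in nhds p, x ≠ 0 ∧ ContDiffAt ℝ 1 F (‖x‖⁻¹ • x) := by
    refine (isOpen_ne.eventually_mem hp0).and ?_
    have h3 : ∀ᶠ x in nhds (‖p‖⁻¹ • p), ContDiffAt ℝ 1 F x := by
      rw [hpp]
      exact (hF.of_le (by norm_cast)).eventually (by simp)
    exact (contDiffAt_normalize hp0).continuousAt.eventually h3
  have hcont : Filter.Tendsto (fun s : ℝ => p + s • u) (nhds 0) (nhds p) := by
    have := hline.continuousAt.tendsto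
    rwa [h0] at this
  filter_upwards [hcont.eventually hev] with s hs
  rw [fderiv_fun_comp (g := F) (f := fun y => ‖y‖⁻¹ • y) _ (hs.2.differentiableAt (by simp))
    ((contDiffAt_normalize hs.1).differentiableAt (by simp)),
    ContinuousLinearMap.comp_apply, fderiv_normalize hs.1]

theorem fderiv_warped_form {x : V} (hx : x ≠ 0) {w : ℝ → ℝ} {b' : ℝ} (hb : HasDerivAt w b' ‖x‖)
    (v z u : V) :
    fderiv ℝ (fun y => ⟪v, z⟫ + w ‖y‖ * (⟪y, v⟫ * ⟪y, z⟫)) x u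
      = b' / ‖x‖ * (⟪x, u⟫ * ⟪x, v⟫ * ⟪x, z⟫)
        + w ‖x‖ * (⟪u, v⟫ * ⟪x, z⟫ + ⟪x, v⟫ * ⟪u, z⟫) := by
  have hin (z : V) : HasFDerivAt (fun y : V => ⟪y, z⟫) (innerSL ℝ z) x := by
    simpa [real_inner_comm] using (innerSL ℝ z).hasFDerivAt (x := x)
  have h : HasFDerivAt (fun y => ⟪v, z⟫ + w ‖y‖ * (⟪y, v⟫ * ⟪y, z⟫)) _ x :=
    ((hb.comp_hasFDerivAt x (hasFDerivAt_norm hx)).mul ((hin v).mul (hin z))).const_add ⟪v, z⟫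
  rw [h.fderiv]
  simp
  rw [real_inner_comm u v, real_inner_comm u z]
  ring

end Normalization

/-! ### The warped metric, its Christoffel symbols and unit normals in Cartesian coordinates. -/

section Ambient

variable {d : ℕ} {f : ℝ → ℝ}

/-- The coefficient `b` for which the warped product metric is `⟪u, v⟫ + b ⟪x, u⟫ ⟪x, v⟫`. -/
def warp (f : ℝ → ℝ) (ρ : ℝ) : ℝ := ((f ρ ^ 2)⁻¹ - 1) / ρ ^ 2

theorem metric_eq (f : ℝ → ℝ) (x u v : E d) :
    metric f x u v = ⟪u, v⟫ + warp f ‖x‖ * (⟪x, u⟫ * ⟪x, v⟫) := by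
  simp only [metric, dr, warp, div_eq_mul_inv]
  ring

theorem fderiv_metric {x : E d} (hx : x ≠ 0) {b' : ℝ} (hb : HasDerivAt (warp f) b' ‖x‖)
    (v w : E d) (u : E d) :
    fderiv ℝ (fun y => metric f y v w) x u = b' / ‖x‖ * (⟪x, u⟫ * ⟪x, v⟫ * ⟪x, w⟫)
      + warp f ‖x‖ * (⟪u, v⟫ * ⟪x, w⟫ + ⟪x, v⟫ * ⟪u, w⟫) := by
  simp only [metric_eq]
  exact fderiv_warped_form hx hb v w u

/-- The terms with `⟪x, u⟫` or `⟪x, v⟫` times `b` cancel in the Koszul combination. What remains is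
proportional to `⟪x, w⟫`, so the connection enters the second fundamental form only through the
radial component of the normal. -/
theorem christoffelFirst_eq {x : E d} (hx : x ≠ 0) {b' : ℝ} (hb : HasDerivAt (warp f) b' ‖x‖)
    (u v w : E d) :
    christoffelFirst f x u v w
      = (b' / (2 * ‖x‖) * (⟪x, u⟫ * ⟪x, v⟫) + warp f ‖x‖ * ⟪u, v⟫) * ⟪x, w⟫ := by
  rw [christoffelFirst, fderiv_metric hx hb, fderiv_metric hx hb,
    fderiv_metric hx hb, real_inner_comm u v, real_inner_comm u w, real_inner_comm v w]
  have : ‖x‖ ≠ 0 := norm_ne_zero_iff.2 hx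
  field_simp
  ring

/-- The vector dual to the Euclidean covector `n` for the warped product metric. -/
def conormalDual (f : ℝ → ℝ) (x n : E d) : E d :=
  n - (warp f ‖x‖ * f ‖x‖ ^ 2 * ⟪x, n⟫) • x

/-- Since `1 + b ‖x‖² = 1 / f²`, the inverse of the rank-one perturbation `1 + b x xᵀ` is `1 - b f²
x xᵀ`. -/
theorem metric_conormalDual {x : E d} (hx : x ≠ 0) (hf : f ‖x‖ ≠ 0) (w n : E d) :
    metric f x w (conormalDual f x n) = ⟪w, n⟫ := by
  have : ‖x‖ ≠ 0 := norm_ne_zero_iff.2 hx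
  rw [metric_eq, conormalDual, inner_sub_right, inner_sub_right, inner_smul_right,
    inner_smul_right, real_inner_self_eq_norm_sq, real_inner_comm x w, warp]
  field_simp
  ring

theorem inner_conormalDual {x : E d} (hx : x ≠ 0) (hf : f ‖x‖ ≠ 0) (n : E d) :
    ⟪x, conormalDual f x n⟫ = f ‖x‖ ^ 2 * ⟪x, n⟫ := by
  have : ‖x‖ ≠ 0 := norm_ne_zero_iff.2 hx
  rw [conormalDual, inner_sub_right, inner_smul_right, real_inner_self_eq_norm_sq, warp]
  field_simp
  ring

/-- The length of `conormalDual f x n` in the warped product metric. -/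
def conormalLength (f : ℝ → ℝ) (x n : E d) : ℝ := √⟪conormalDual f x n, n⟫

/-- Up to the factor `‖x‖²`, the squared length is the Cauchy–Schwarz defect of `x` and `n` plus `f²
⟪x, n⟫²`, and the latter is positive. -/
theorem inner_conormalDual_self_pos {x n : E d} (hx : x ≠ 0) (hf : f ‖x‖ ≠ 0)
    (hn : ⟪x, n⟫ ≠ 0) : 0 < ⟪conormalDual f x n, n⟫ := by
  have h0 : 0 < ‖x‖ := norm_pos_iff.2 hx
  have hcs : ⟪x, n⟫ ^ 2 ≤ ‖x‖ ^ 2 * ‖n‖ ^ 2 := by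
    rw [← mul_pow, ← sq_abs]
    exact pow_le_pow_left₀ (abs_nonneg _) (abs_real_inner_le_norm x n) 2
  have heq : ‖x‖ ^ 2 * ⟪conormalDual f x n, n⟫
      = (‖x‖ ^ 2 * ‖n‖ ^ 2 - ⟪x, n⟫ ^ 2) + f ‖x‖ ^ 2 * ⟪x, n⟫ ^ 2 := by
    rw [conormalDual, inner_sub_left, inner_smul_left, real_inner_self_eq_norm_sq, warp]
    simp only [conj_trivial]
    field_simp
    ring
  have h1 : 0 < f ‖x‖ ^ 2 * ⟪x, n⟫ ^ 2 := by positivity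
  have h2 : 0 < ‖x‖ ^ 2 * ⟪conormalDual f x n, n⟫ := by rw [heq]; linarith
  exact pos_of_mul_pos_right h2 (sq_nonneg _)

/-- The unit normal for the warped product metric with Euclidean conormal direction `n`. -/
def unitNormal (f : ℝ → ℝ) (x n : E d) : E d := (conormalLength f x n)⁻¹ • conormalDual f x n

theorem metric_smul_right (f : ℝ → ℝ) (x u v : E d) (c : ℝ) :
    metric f x u (c • v) = c * metric f x u v := by
  simp only [metric_eq, inner_smul_right]
  ring

theorem metric_comm (f : ℝ → ℝ) (x u v : E d) : metric f x u v = metric f x v u := by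
  rw [metric_eq, metric_eq, real_inner_comm u v, mul_comm ⟪x, u⟫]

end Ambient

/-! ### Normals and second fundamental forms from a Euclidean conormal. -/

section Hypersurfaces

variable {m : ℕ} {f : ℝ → ℝ} {Y n : S m → E (m + 1)}

theorem isOuterUnitNormal_unitNormal (hf : ∀ p, f ‖Y p‖ ≠ 0)
    (hn : ∀ p : S m, ∀ v, IsTangent p v → ⟪diff Y p v, n p⟫ = 0) (hY : ∀ p, 0 < ⟪Y p, n p⟫) :
    IsOuterUnitNormal f Y fun p => unitNormal f (Y p) (n p) := by
  have hY0 (p : S m) : Y p ≠ 0 := fun h => by simpa [h] using hY p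
  have hL (p : S m) : 0 < conormalLength f (Y p) (n p) :=
    Real.sqrt_pos.2 (inner_conormalDual_self_pos (hY0 p) (hf p) (hY p).ne')
  refine ⟨fun p => ?_, fun p v hv => ?_, fun p => ?_⟩
  · rw [unitNormal, metric_smul_right, metric_comm, metric_smul_right,
      metric_conormalDual (hY0 p) (hf p)]
    have : conormalLength f (Y p) (n p) ^ 2 = ⟪conormalDual f (Y p) (n p), n p⟫ :=
      Real.sq_sqrt (inner_conormalDual_self_pos (hY0 p) (hf p) (hY p).ne').le
    rw [← this]
    have := (hL p).ne'
    field_simp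
  · rw [unitNormal, metric_comm, metric_smul_right, metric_conormalDual (hY0 p) (hf p), hn p v hv,
      mul_zero]
  · rw [unitNormal, metric_comm, metric_smul_right, metric_conormalDual (hY0 p) (hf p)]
    exact mul_pos (inv_pos.2 (hL p)) (hY p)

/-- Pairing with the dual of `n` in the warped metric is Euclidean pairing with `n`, so only
Euclidean products remain to be computed. -/
theorem secondForm_unitNormal (p : S m) (hY : Y p ≠ 0) (hf : f ‖Y p‖ ≠ 0) {b' : ℝ}
    (hb : HasDerivAt (warp f) b' ‖Y p‖) (u v : E (m + 1)) :
    secondForm f Y (fun p => unitNormal f (Y p) (n p)) p u v =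
      (conormalLength f (Y p) (n p))⁻¹ *
        (-⟪fderiv ℝ (fderiv ℝ (radialExt Y)) (p : E (m + 1)) u v, n p⟫
          - f ‖Y p‖ ^ 2 * ⟪Y p, n p⟫ * (b' / (2 * ‖Y p‖) * (⟪Y p, diff Y p u⟫ * ⟪Y p, diff Y p v⟫)
            + warp f ‖Y p‖ * ⟪diff Y p u, diff Y p v⟫)) := by
  rw [secondForm, christoffelFirst_eq hY hb, unitNormal, metric_smul_right, inner_smul_right,
    metric_conormalDual hY hf, inner_conormalDual hY hf]
  ring

end Hypersurfaces

/-! ### Differentials on the sphere computed from an ambient formula. -/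

section RadialExtension

variable {m : ℕ} {Y : S m → E (m + 1)} {F : E (m + 1) → E (m + 1)}

theorem norm_coe_sphere (p : S m) : ‖(p : E (m + 1))‖ = 1 := norm_eq_of_mem_sphere p

theorem coe_sphere_ne_zero (p : S m) : (p : E (m + 1)) ≠ 0 := by
  rw [← norm_ne_zero_iff, norm_coe_sphere]
  exact one_ne_zero

theorem radialExt_eventuallyEq (hF : ∀ p : S m, Y p = F p) {x : E (m + 1)} (hx : x ≠ 0) :
    radialExt Y =ᶠ[nhds x] fun y => F (‖y‖⁻¹ • y) := by
  filter_upwards [isOpen_ne.mem_nhds hx] with y hy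
  rw [radialExt, dif_pos hy, hF]

theorem radialExt_coe (Y : S m → E (m + 1)) (p : S m) : radialExt Y p = Y p := by
  rw [radialExt, dif_pos (coe_sphere_ne_zero p)]
  congr
  simp

theorem diff_eq_fderiv (hF : ∀ p : S m, Y p = F p) (p : S m) (hd : DifferentiableAt ℝ F p)
    {v : E (m + 1)} (hv : IsTangent p v) : diff Y p v = fderiv ℝ F p v := by
  rw [diff, (radialExt_eventuallyEq hF (coe_sphere_ne_zero p)).fderiv_eq]
  exact fderiv_comp_normalize (norm_coe_sphere p) hd hv

theorem fderiv_fderiv_radialExt (hF : ∀ p : S m, Y p = F p) (p : S m) (hd : ContDiffAt ℝ ∞ F p)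
    {u v : E (m + 1)} (hu : IsTangent p u) (hv : IsTangent p v) :
    fderiv ℝ (fderiv ℝ (radialExt Y)) (p : E (m + 1)) u v
      = fderiv ℝ (fderiv ℝ F) p u v - ⟪u, v⟫ • fderiv ℝ F p p := by
  rw [(radialExt_eventuallyEq hF (coe_sphere_ne_zero p)).fderiv.fderiv_eq]
  exact fderiv_fderiv_comp_normalize (norm_coe_sphere p) hd hu hv

end RadialExtension

/-! ### Euclidean computations for the height-dependent shift. -/

section ShiftMap

variable {V : Type*} [NormedAddCommGroup V] [InnerProductSpace ℝ V] {e : V} {r : ℝ} {W : ℝ → ℝ}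

/-- The sphere of radius `r`, shifted in the direction `e` by a function of the height. -/
def shiftMap (e : V) (r : ℝ) (W : ℝ → ℝ) (y : V) : V := r • y + W (r * ⟪e, y⟫) • e

theorem hasFDerivAt_height (e : V) (r : ℝ) (y : V) :
    HasFDerivAt (fun y : V => r * ⟪e, y⟫) (r • innerSL ℝ e) y := by
  simpa using ((innerSL ℝ e).hasFDerivAt (x := y)).const_mul r

theorem contDiffAt_shiftMap {y : V} (hW : ContDiffAt ℝ ∞ W (r * ⟪e, y⟫)) :
    ContDiffAt ℝ ∞ (shiftMap e r W) y := by
  have h : ContDiffAt ℝ ∞ (fun y : V => W (r * ⟪e, y⟫)) y :=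
    ContDiffAt.comp y hW (contDiffAt_const.mul (contDiffAt_const.inner ℝ contDiffAt_id))
  exact (contDiffAt_const.smul contDiffAt_id).add (h.smul contDiffAt_const)

theorem fderiv_shiftMap {y : V} (hW : DifferentiableAt ℝ W (r * ⟪e, y⟫)) (v : V) :
    fderiv ℝ (shiftMap e r W) y v = r • v + (deriv W (r * ⟪e, y⟫) * (r * ⟪e, v⟫)) • e := by
  have h : HasFDerivAt (shiftMap e r W) _ y :=
    ((hasFDerivAt_id y).const_smul r).add
      ((hW.hasDerivAt.comp_hasFDerivAt y (hasFDerivAt_height e r y)).smul_const e)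
  rw [h.fderiv]
  simp

theorem fderiv_fderiv_shiftMap {y : V} (hW : ContDiffAt ℝ ∞ W (r * ⟪e, y⟫)) (u v : V) :
    fderiv ℝ (fderiv ℝ (shiftMap e r W)) y u v
      = (deriv (deriv W) (r * ⟪e, y⟫) * (r * ⟪e, u⟫) * (r * ⟪e, v⟫)) • e := by
  have hd : DifferentiableAt ℝ (fderiv ℝ (shiftMap e r W)) y :=
    ((contDiffAt_shiftMap hW).fderiv_right (m := 1) (by norm_cast)).differentiableAt (by simp)
  have hd' : DifferentiableAt ℝ (deriv W) (r * ⟪e, y⟫) := by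
    have h1 := (hW.fderiv_right (m := 1) (by norm_cast)).differentiableAt (by simp)
    exact h1.clm_apply (differentiableAt_const (1 : ℝ))
  have h1 : fderiv ℝ (fderiv ℝ (shiftMap e r W)) y u v
      = fderiv ℝ (fun z => fderiv ℝ (shiftMap e r W) z v) y u := by
    rw [fderiv_clm_apply hd (differentiableAt_const _)]
    simp
  have hev : (fun z => fderiv ℝ (shiftMap e r W) z v)
      =ᶠ[nhds y] fun z => r • v + (deriv W (r * ⟪e, z⟫) * (r * ⟪e, v⟫)) • e := by
    have h3 : ∀ᶠ t in nhds (r * ⟪e, y⟫), ContDiffAt ℝ 1 W t :=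
      (hW.of_le (by norm_cast)).eventually (by simp)
    filter_upwards [(hasFDerivAt_height e r y).continuousAt.eventually h3] with z hz
    exact fderiv_shiftMap (hz.differentiableAt (by simp)) v
  have h2 : HasFDerivAt (fun z => r • v + (deriv W (r * ⟪e, z⟫) * (r * ⟪e, v⟫)) • e) _ y :=
    (((hd'.hasDerivAt.comp_hasFDerivAt y (hasFDerivAt_height e r y)).mul_const
      (r * ⟪e, v⟫)).smul_const e).const_add (r • v)
  rw [h1, hev.fderiv_eq, h2.fderiv]
  simp only [ContinuousLinearMap.smulRight_apply, _root_.smul_apply, innerSL_apply_apply,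
    smul_eq_mul]
  congr 1
  ring

theorem norm_shiftMap_sq (he : ‖e‖ = 1) {p : V} (hp : ‖p‖ = 1) :
    ‖shiftMap e r W p‖ ^ 2 = r ^ 2 + 2 * (r * ⟪e, p⟫) * W (r * ⟪e, p⟫) + W (r * ⟪e, p⟫) ^ 2 := by
  rw [shiftMap, norm_add_sq_real, norm_smul, norm_smul, hp, he, inner_smul_left, inner_smul_right,
    real_inner_comm e p]
  simp only [conj_trivial, mul_one, Real.norm_eq_abs, sq_abs]
  ring

/-- The Euclidean conormal of the shifted sphere, for the slope `q = W'`. -/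
def shiftNormal (e : V) (q : ℝ) (p : V) : V := (1 + q) • p - (q * ⟪e, p⟫) • e

variable {p : V} {q w : ℝ}

theorem inner_shiftNormal_tangent (he : ‖e‖ = 1) {v : V} (hv : ⟪p, v⟫ = 0) :
    ⟪r • v + (q * (r * ⟪e, v⟫)) • e, shiftNormal e q p⟫ = 0 := by
  have hee : ⟪e, e⟫ = 1 := by rw [real_inner_self_eq_norm_sq, he, one_pow]
  simp only [shiftNormal, inner_add_left, inner_sub_right, inner_smul_left, inner_smul_right,
    conj_trivial, hee, real_inner_comm p v, real_inner_comm e v, hv]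
  ring

/-- The Euclidean product of the conormal of the shifted sphere with its position vector. -/
def support (r t w q : ℝ) : ℝ := ((1 + q) * (r ^ 2 - t ^ 2) + t * (t + w)) / r

theorem inner_shiftNormal_position (he : ‖e‖ = 1) (hp : ‖p‖ = 1) (hr : r ≠ 0) :
    ⟪r • p + w • e, shiftNormal e q p⟫ = support r (r * ⟪e, p⟫) w q := by
  have hee : ⟪e, e⟫ = 1 := by rw [real_inner_self_eq_norm_sq, he, one_pow]
  have hpp : ⟪p, p⟫ = 1 := by rw [real_inner_self_eq_norm_sq, hp, one_pow]
  simp only [shiftNormal, support, inner_add_left, inner_sub_right, inner_smul_left,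
    inner_smul_right, conj_trivial, hee, hpp, real_inner_comm e p]
  field_simp
  ring

theorem inner_position_tangent (he : ‖e‖ = 1) {v : V} (hv : ⟪p, v⟫ = 0) :
    ⟪r • p + w • e, r • v + (q * (r * ⟪e, v⟫)) • e⟫
      = r * ⟪e, v⟫ * (r * ⟪e, p⟫ * q + w + w * q) := by
  have hee : ⟪e, e⟫ = 1 := by rw [real_inner_self_eq_norm_sq, he, one_pow]
  simp only [inner_add_left, inner_add_right, inner_smul_left,
    inner_smul_right, conj_trivial, hee, hv, real_inner_comm e p]
  ring

theorem inner_tangent_tangent (he : ‖e‖ = 1) (u v : V) :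
    ⟪r • u + (q * (r * ⟪e, u⟫)) • e, r • v + (q * (r * ⟪e, v⟫)) • e⟫
      = r ^ 2 * ⟪u, v⟫ + r ^ 2 * ⟪e, u⟫ * ⟪e, v⟫ * (2 * q + q ^ 2) := by
  have hee : ⟪e, e⟫ = 1 := by rw [real_inner_self_eq_norm_sq, he, one_pow]
  simp only [inner_add_left, inner_add_right, inner_smul_left,
    inner_smul_right, conj_trivial, hee, real_inner_comm e u]
  ring

theorem inner_second_shiftNormal (he : ‖e‖ = 1) (hp : ‖p‖ = 1) (c a : ℝ) :
    ⟪c • e - a • (r • p + (q * (r * ⟪e, p⟫)) • e), shiftNormal e q p⟫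
      = c * ⟪e, p⟫ - a * (r * (1 + q)) := by
  have hee : ⟪e, e⟫ = 1 := by rw [real_inner_self_eq_norm_sq, he, one_pow]
  have hpp : ⟪p, p⟫ = 1 := by rw [real_inner_self_eq_norm_sq, hp, one_pow]
  simp only [shiftNormal, inner_add_left, inner_sub_left, inner_sub_right, inner_smul_left,
    inner_smul_right, conj_trivial, hee, hpp, real_inner_comm e p]
  ring

end ShiftMap

/-! ### Geometry of shifted spheres in the warped metric. -/

section ShiftedSphere

variable {m : ℕ} {e : E (m + 1)} {r : ℝ} {W f : ℝ → ℝ}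

/-- The restriction of `shiftMap` to the unit sphere. -/
def shiftedSphere (e : E (m + 1)) (r : ℝ) (W : ℝ → ℝ) (p : S m) : E (m + 1) :=
  shiftMap e r W p

theorem shiftedSphere_zero (e : E (m + 1)) (r : ℝ) : shiftedSphere e r 0 = slice m r := by
  ext1 p
  simp [shiftedSphere, shiftMap, slice]

theorem diff_shiftedSphere {p : S m} (hW : DifferentiableAt ℝ W (r * ⟪e, (p : E (m + 1))⟫))
    {v : E (m + 1)} (hv : IsTangent p v) :
    diff (shiftedSphere e r W) p v
      = r • v + (deriv W (r * ⟪e, (p : E (m + 1))⟫) * (r * ⟪e, v⟫)) • e := by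
  have hd : DifferentiableAt ℝ (shiftMap e r W) p :=
    (differentiableAt_id.const_smul r).add
      ((hW.comp (p : E (m + 1)) (hasFDerivAt_height e r _).differentiableAt).smul_const e)
  rw [diff_eq_fderiv (Y := shiftedSphere e r W) (F := shiftMap e r W) (fun _ => rfl) p hd hv, fderiv_shiftMap hW]

/-- The isometry condition on the height function `w` with slope `q` at height `t`, for the
coefficient `b` of the warped product metric. -/
def IsIsometricSlope (b t w q : ℝ) : Prop := 2 * q + q ^ 2 + b * (t * q + w + w * q) ^ 2 = 0

/-- The deviation from `r² ⟪u, v⟫` is `r² ⟪e, u⟫⟪e, v⟫` times the left side of `IsIsometricSlope`,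
which is why a single scalar equation suffices. -/
theorem firstForm_shiftedSphere (he : ‖e‖ = 1) {p : S m}
    (hW : DifferentiableAt ℝ W (r * ⟪e, (p : E (m + 1))⟫))
    (hq : IsIsometricSlope (warp f ‖shiftedSphere e r W p‖) (r * ⟪e, (p : E (m + 1))⟫)
      (W (r * ⟪e, (p : E (m + 1))⟫)) (deriv W (r * ⟪e, (p : E (m + 1))⟫)))
    {u v : E (m + 1)} (hu : IsTangent p u) (hv : IsTangent p v) :
    firstForm f (shiftedSphere e r W) p u v = r ^ 2 * ⟪u, v⟫ := by
  rw [firstForm, radialExt_coe, metric_eq, diff_shiftedSphere hW hu, diff_shiftedSphere hW hv,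
    inner_tangent_tangent he]
  rw [IsIsometricSlope] at hq
  have h1 := inner_position_tangent (r := r) (p := (p : E (m + 1)))
    (w := W (r * ⟪e, (p : E (m + 1))⟫)) (q := deriv W (r * ⟪e, (p : E (m + 1))⟫)) he hu
  have h2 := inner_position_tangent (r := r) (p := (p : E (m + 1)))
    (w := W (r * ⟪e, (p : E (m + 1))⟫)) (q := deriv W (r * ⟪e, (p : E (m + 1))⟫)) he hv
  rw [show shiftedSphere e r W p = r • (p : E (m + 1)) + W (r * ⟪e, (p : E (m + 1))⟫) • e from rfl]
    at hq ⊢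
  rw [h1, h2]
  linear_combination r ^ 2 * ⟪e, u⟫ * ⟪e, v⟫ * hq

/-- The coefficient of `‖v‖²` in the second fundamental form of a shifted sphere. -/
def hessNorm (F b r t w q : ℝ) : ℝ := r * (1 + q) - F ^ 2 * b * r ^ 2 * support r t w q

/-- The coefficient of `⟪e, v⟫²` in the second fundamental form of a shifted sphere. -/
def hessAxis (F b c r t w q q₂ : ℝ) : ℝ :=
  -(t * r * q₂) - F ^ 2 * support r t w q * r ^ 2 *
    (c * (t * q + w + w * q) ^ 2 + b * (2 * q + q ^ 2))

/-- The unit normal of a shifted sphere. -/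
def shiftedNormal (f : ℝ → ℝ) (e : E (m + 1)) (r : ℝ) (W : ℝ → ℝ) (p : S m) : E (m + 1) :=
  unitNormal f (shiftedSphere e r W p)
    (shiftNormal e (deriv W (r * ⟪e, (p : E (m + 1))⟫)) (p : E (m + 1)))

theorem isOuterUnitNormal_shiftedNormal (he : ‖e‖ = 1) (hr : r ≠ 0)
    (hf : ∀ p : S m, f ‖shiftedSphere e r W p‖ ≠ 0)
    (hW : ∀ p : S m, DifferentiableAt ℝ W (r * ⟪e, (p : E (m + 1))⟫))
    (hs : ∀ p : S m, 0 < support r (r * ⟪e, (p : E (m + 1))⟫) (W (r * ⟪e, (p : E (m + 1))⟫))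
      (deriv W (r * ⟪e, (p : E (m + 1))⟫))) :
    IsOuterUnitNormal f (shiftedSphere e r W) (shiftedNormal f e r W) := by
  refine isOuterUnitNormal_unitNormal
    (n := fun p : S m => shiftNormal e (deriv W (r * ⟪e, (p : E (m + 1))⟫)) (p : E (m + 1)))
    hf (fun p v hv => ?_) fun p => ?_
  · rw [diff_shiftedSphere (hW p) hv, inner_shiftNormal_tangent he hv]
  · exact (hs p).trans_eq (inner_shiftNormal_position he (norm_coe_sphere p) hr).symm

/-- The second derivative of the shift points along `e`, and the Christoffel term sees `v` only
through `⟪Y, dY v⟫` and `‖dY v‖²`; hence only `‖v‖²` and `⟪e, v⟫²` appear. -/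
theorem secondForm_shiftedSphere (he : ‖e‖ = 1) (hr : r ≠ 0) {p : S m}
    (hW : ContDiffAt ℝ ∞ W (r * ⟪e, (p : E (m + 1))⟫)) (hY : shiftedSphere e r W p ≠ 0)
    (hf : f ‖shiftedSphere e r W p‖ ≠ 0) {b' : ℝ}
    (hb : HasDerivAt (warp f) b' ‖shiftedSphere e r W p‖) {v : E (m + 1)} (hv : IsTangent p v)
    {t w q q₂ : ℝ} (ht : r * ⟪e, (p : E (m + 1))⟫ = t) (hw : W t = w) (hq : deriv W t = q)
    (hq₂ : deriv (deriv W) t = q₂) :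
    secondForm f (shiftedSphere e r W) (shiftedNormal f e r W) p v v =
      (conormalLength f (shiftedSphere e r W p) (shiftNormal e q (p : E (m + 1))))⁻¹ *
        (hessNorm (f ‖shiftedSphere e r W p‖) (warp f ‖shiftedSphere e r W p‖) r t w q * ‖v‖ ^ 2
          + hessAxis (f ‖shiftedSphere e r W p‖) (warp f ‖shiftedSphere e r W p‖)
            (b' / (2 * ‖shiftedSphere e r W p‖)) r t w q q₂ * ⟪e, v⟫ ^ 2) := by
  subst ht hw hq hq₂
  have hd := hW.differentiableAt (by simp)
  have hsec := secondForm_unitNormal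
    (n := fun p : S m => shiftNormal e (deriv W (r * ⟪e, (p : E (m + 1))⟫)) (p : E (m + 1)))
    p hY hf hb v v
  rw [fderiv_fderiv_radialExt (Y := shiftedSphere e r W) (F := shiftMap e r W)
      (fun _ => rfl) p (contDiffAt_shiftMap hW) hv hv,
    fderiv_fderiv_shiftMap hW, fderiv_shiftMap hd, diff_shiftedSphere hd hv,
    inner_second_shiftNormal he (norm_coe_sphere p), inner_tangent_tangent he] at hsec
  have h1 := inner_position_tangent (r := r) (p := (p : E (m + 1)))
    (w := W (r * ⟪e, (p : E (m + 1))⟫)) (q := deriv W (r * ⟪e, (p : E (m + 1))⟫)) he hv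
  have h2 := inner_shiftNormal_position (w := W (r * ⟪e, (p : E (m + 1))⟫))
    (q := deriv W (r * ⟪e, (p : E (m + 1))⟫)) he (norm_coe_sphere p) hr
  change ⟪shiftedSphere e r W p, _⟫ = _ at h1
  change ⟪shiftedSphere e r W p, _⟫ = _ at h2
  rw [h1, h2, real_inner_self_eq_norm_sq] at hsec
  refine hsec.trans ?_
  rw [hessNorm, hessAxis]
  ring

/-- The `e`-component of `Y p` is `t + W t`, strictly increasing because `1 + W' > 0`. It determines
the height, hence the shift, hence `p`; the linearised argument gives the immersion. -/
theorem isEmbeddedSphere_shiftedSphere (he : ‖e‖ = 1) (hr : 0 < r) {I : Set ℝ} {R : ℝ} (hR : r < R)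
    (hW : ContDiffOn ℝ ∞ W (Ioo (-R) R)) (hslope : ∀ t ∈ Ioo (-R) R, 0 < 1 + deriv W t)
    (hI : ∀ p : S m, ‖shiftedSphere e r W p‖ ∈ I) :
    IsEmbeddedSphere I (shiftedSphere e r W) := by
  have hee : ⟪e, e⟫ = 1 := by rw [real_inner_self_eq_norm_sq, he, one_pow]
  have hmem (p : S m) : r * ⟪e, (p : E (m + 1))⟫ ∈ Ioo (-R) R := by
    have h := abs_real_inner_le_norm e (p : E (m + 1))
    rw [he, norm_coe_sphere, one_mul] at h
    have := abs_le.1 h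
    constructor <;> nlinarith
  have hat {t : ℝ} (ht : t ∈ Ioo (-R) R) : ContDiffAt ℝ ∞ W t :=
    hW.contDiffAt (Ioo_mem_nhds ht.1 ht.2)
  have hmono : StrictMonoOn (fun t => t + W t) (Ioo (-R) R) := by
    refine strictMonoOn_of_deriv_pos (convex_Ioo _ _) (continuousOn_id.add hW.continuousOn)
      fun t ht => ?_
    rw [interior_Ioo] at ht
    rw [deriv_fun_add (f := fun t => t) differentiableAt_id ((hat ht).differentiableAt (by simp))]
    simpa using hslope t ht
  refine ⟨fun p => ?_, fun p p' hpp => ?_, fun p v hv h0 => ?_, hI⟩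
  · have : Fact (Module.finrank ℝ (E (m + 1)) = m + 1) := ⟨by simp⟩
    exact (contDiffAt_shiftMap (hat (hmem p))).contMDiffAt.comp p
      (contMDiff_coe_sphere (E := E (m + 1)) (n := m)).contMDiffAt
  · change r • (p : E (m + 1)) + W (r * ⟪e, (p : E (m + 1))⟫) • e
      = r • (p' : E (m + 1)) + W (r * ⟪e, (p' : E (m + 1))⟫) • e at hpp
    have h1 := congrArg (fun x => ⟪e, x⟫) hpp
    simp only [inner_add_right, inner_smul_right, hee, mul_one] at h1
    have h2 := hmono.injOn (hmem p) (hmem p') h1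
    rw [h2, add_left_inj] at hpp
    exact Subtype.ext (smul_right_injective _ hr.ne' hpp)
  · rw [diff_shiftedSphere ((hat (hmem p)).differentiableAt (by simp)) hv] at h0
    have h1 := congrArg (fun x => ⟪e, x⟫) h0
    simp only [inner_add_right, inner_smul_right, hee, inner_zero_right] at h1
    have h2 : r * (1 + deriv W (r * ⟪e, (p : E (m + 1))⟫)) * ⟪e, v⟫ = 0 := by linarith
    have h3 : ⟪e, v⟫ = 0 :=
      (mul_eq_zero.1 h2).resolve_left (mul_pos hr (hslope _ (hmem p))).ne'
    rw [h3, mul_zero, mul_zero, zero_smul, add_zero] at h0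
    exact (smul_eq_zero.1 h0).resolve_left hr.ne'

end ShiftedSphere

/-! ### Distance to the slice in `C^k`. -/

section CkBound

open Nat in
/-- The `C^k` distance of a shifted sphere from the slice is controlled by the derivatives of the
height function. -/
theorem exists_ckClose_bound {m : ℕ} {e : E (m + 1)} (he : ‖e‖ = 1) (r : ℝ) (k : ℕ) :
    ∃ C > 0, ∀ (W : ℝ → ℝ) (J : Set ℝ) (η : ℝ), IsOpen J → ContDiffOn ℝ ∞ W J →
      (∀ p : S m, r * ⟪e, (p : E (m + 1))⟫ ∈ J) →
      (∀ j ≤ k, ∀ p : S m, |iteratedDeriv j W (r * ⟪e, (p : E (m + 1))⟫)| ≤ η) →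
      ∀ j ≤ k, ∀ p : S m,
        ‖iteratedFDeriv ℝ j (fun x => radialExt (shiftedSphere e r W) x
          - radialExt (slice m r) x) (p : E (m + 1))‖ ≤ C * η := by
  set τ : E (m + 1) → ℝ := fun x => r * ⟪e, ‖x‖⁻¹ • x⟫
  have hτ : ContDiffOn ℝ ∞ τ {x | x ≠ 0} := fun x hx =>
    (contDiffAt_const.mul (contDiffAt_const.inner ℝ
      (contDiffAt_normalize hx))).contDiffWithinAt
  have hbound (j : ℕ) : ∃ D, ∀ x ∈ Metric.sphere (0 : E (m + 1)) 1,
      ‖iteratedFDeriv ℝ j τ x‖ ≤ D := by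
    refine (isCompact_sphere _ _).exists_bound_of_continuousOn fun x hx => ?_
    have hx0 : x ≠ 0 := coe_sphere_ne_zero ⟨x, hx⟩
    have h : ContinuousOn (iteratedFDeriv ℝ j τ) {x | x ≠ 0} :=
      (hτ.continuousOn_iteratedFDerivWithin (m := j) (by norm_cast; exact le_top)
        isOpen_ne.uniqueDiffOn).congr
          fun y hy => (iteratedFDerivWithin_of_isOpen j isOpen_ne hy).symm
    exact (h.continuousAt (isOpen_ne.mem_nhds hx0)).continuousWithinAt
  choose D hD using hbound
  -- One constant at least `1` dominates all `D i` with `i ≤ k`; then `D₀ ≤ D₀ ^ i` for `i ≥ 1`, the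
  -- form needed by the bound for derivatives of a composition.
  set D₀ : ℝ := 1 + ∑ j ∈ Finset.range (k + 1), |D j|
  have hD₀ : 1 ≤ D₀ := le_add_of_nonneg_right (Finset.sum_nonneg fun _ _ => abs_nonneg _)
  refine ⟨k ! * D₀ ^ k, by positivity, fun W J η hJ hW hmem hη j hj p => ?_⟩
  have hη0 : 0 ≤ η := (abs_nonneg _).trans (hη 0 (Nat.zero_le _) p)
  have hp0 := coe_sphere_ne_zero p
  have hτp (p : S m) : τ p = r * ⟪e, (p : E (m + 1))⟫ := by simp [τ]
  set s : Set (E (m + 1)) := {x | x ≠ 0} ∩ τ ⁻¹' J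
  have hs : IsOpen s := hτ.continuousOn.isOpen_inter_preimage isOpen_ne hJ
  have hps : (p : E (m + 1)) ∈ s := ⟨hp0, by rw [mem_preimage, hτp]; exact hmem p⟩
  -- The difference of the two extensions is `W ∘ τ` times the unit vector `e`, so its derivatives
  -- have the norms of those of a scalar composition.
  have hev : (fun x => radialExt (shiftedSphere e r W) x - radialExt (slice m r) x)
      =ᶠ[nhds (p : E (m + 1))] (LinearIsometry.toSpanSingleton ℝ _ he) ∘ (W ∘ τ) := by
    filter_upwards [radialExt_eventuallyEq (Y := shiftedSphere e r W) (F := shiftMap e r W)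
      (fun _ => rfl) hp0, radialExt_eventuallyEq (Y := slice m r) (F := fun y => r • y)
      (fun _ => rfl) hp0] with x h1 h2
    rw [h1, h2]
    simp [shiftMap, τ]
  have hWτ : ContDiffOn ℝ ∞ (W ∘ τ) s := hW.comp (hτ.mono inter_subset_left) fun x hx => hx.2
  rw [(hev.iteratedFDeriv ℝ j).eq_of_nhds, ← iteratedFDerivWithin_of_isOpen j hs hps,
    LinearIsometry.norm_iteratedFDerivWithin_comp_left (n := ∞) _
      (hWτ _ hps) hs.uniqueDiffOn hps
      (by norm_cast; exact le_top)]
  have hjk : (j ! : ℝ) * D₀ ^ j ≤ k ! * D₀ ^ k :=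
    mul_le_mul (by exact_mod_cast Nat.factorial_le hj) (pow_le_pow_right₀ hD₀ hj) (by positivity)
      (by positivity)
  calc ‖iteratedFDerivWithin ℝ j (W ∘ τ) s p‖ ≤ j ! * η * D₀ ^ j := by
        refine norm_iteratedFDerivWithin_comp_le hW (hτ.mono inter_subset_left)
          (by norm_cast; exact le_top) hJ.uniqueDiffOn hs.uniqueDiffOn inter_subset_right hps
          (fun i hi => ?_) fun i hi1 hi => ?_
        · rw [iteratedFDerivWithin_of_isOpen i hJ hps.2, norm_iteratedFDeriv_eq_norm_iteratedDeriv,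
            hτp]
          exact hη i (hi.trans hj) p
        · rw [iteratedFDerivWithin_of_isOpen i hs hps]
          have h1 : |D i| ≤ ∑ j ∈ Finset.range (k + 1), |D j| :=
            Finset.single_le_sum (f := fun j => |D j|) (fun _ _ => abs_nonneg _)
              (Finset.mem_range.2 (by omega))
          calc ‖iteratedFDeriv ℝ i τ p‖ ≤ D i := hD i p p.2
            _ ≤ D₀ := by linarith [le_abs_self (D i)]
            _ ≤ D₀ ^ i := le_self_pow₀ hD₀ (by omega)
    _ = j ! * D₀ ^ j * η := by ring
    _ ≤ k ! * D₀ ^ k * η := mul_le_mul_of_nonneg_right hjk hη0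

end CkBound

/-! ### Solving the isometry condition for the slope, and the open conditions. -/

section Slope

variable {I : Set ℝ} {f : ℝ → ℝ} {r : ℝ}

theorem contDiffOn_warp (hI_pos : I ⊆ Ioi 0) (hf : ContDiffOn ℝ ∞ f I)
    (hf_pos : ∀ t ∈ I, 0 < f t) : ContDiffOn ℝ ∞ (warp f) I :=
  (((hf.pow 2).inv fun _ ht => (pow_pos (hf_pos _ ht) 2).ne').sub contDiffOn_const).div
    (contDiffOn_id.pow 2) fun _ ht => (pow_pos (mem_Ioi.1 (hI_pos ht)) 2).ne'

/-- The distance to the origin of the point of a shifted sphere with height `p.1` and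
shift `p.2`. -/
def radius (r : ℝ) (p : ℝ × ℝ) : ℝ := √(r ^ 2 + 2 * p.1 * p.2 + p.2 ^ 2)

/-- Half of the linear coefficient of the quadratic equation for the slope. -/
def slopeLinear (f : ℝ → ℝ) (r : ℝ) (p : ℝ × ℝ) : ℝ :=
  1 + warp f (radius r p) * p.2 * (p.1 + p.2)

/-- The discriminant of the quadratic equation for the slope. -/
def slopeDisc (f : ℝ → ℝ) (r : ℝ) (p : ℝ × ℝ) : ℝ :=
  slopeLinear f r p ^ 2
    - (1 + warp f (radius r p) * (p.1 + p.2) ^ 2) * (warp f (radius r p) * p.2 ^ 2)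

/-- The slope divided by the square of the shift. -/
def slopeCoeff (f : ℝ → ℝ) (r : ℝ) (p : ℝ × ℝ) : ℝ :=
  -warp f (radius r p) / (slopeLinear f r p + √(slopeDisc f r p))

/-- The slope of the height function of an isometric shifted sphere. -/
def slope (f : ℝ → ℝ) (r : ℝ) (p : ℝ × ℝ) : ℝ := p.2 ^ 2 * slopeCoeff f r p

/-- The points whose radius lies in `I`. -/
def radiusDomain (I : Set ℝ) (r : ℝ) : Set (ℝ × ℝ) :=
  {p | 0 < r ^ 2 + 2 * p.1 * p.2 + p.2 ^ 2 ∧ radius r p ∈ I}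

/-- The domain of the slope function. -/
def slopeDomain (I : Set ℝ) (f : ℝ → ℝ) (r : ℝ) : Set (ℝ × ℝ) :=
  {p | p ∈ radiusDomain I r ∧ 0 < slopeLinear f r p ∧ 0 < slopeDisc f r p}

/-- Expanded in `q`, the condition is `(1 + b(t + w)²) q² + 2Bq + b w² = 0` with `B = slopeLinear`.
The rationalised root `-b w² / (B + √disc)` shows the factor `w²` and never divides by the leading
coefficient. -/
theorem isIsometricSlope_slope {p : ℝ × ℝ} (hp : p ∈ slopeDomain I f r) :
    IsIsometricSlope (warp f (radius r p)) p.1 p.2 (slope f r p) := by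
  obtain ⟨t, w⟩ := p
  have hs := Real.sq_sqrt hp.2.2.le
  have h0 : slopeLinear f r (t, w) + √(slopeDisc f r (t, w)) ≠ 0 :=
    (add_pos_of_pos_of_nonneg hp.2.1 (Real.sqrt_nonneg _)).ne'
  rw [IsIsometricSlope, slope, slopeCoeff]
  set s := √(slopeDisc f r (t, w))
  rw [slopeDisc] at hs
  set b := warp f (radius r (t, w))
  have hB : slopeLinear f r (t, w) = 1 + b * w * (t + w) := rfl
  set B := slopeLinear f r (t, w)
  simp only at hs ⊢
  set q := w ^ 2 * (-b / (B + s)) with hq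
  have hqs : q * (B + s) = -b * w ^ 2 := by rw [hq]; field_simp
  have key : (B + s) ^ 2 * (2 * q + q ^ 2 + b * (t * q + w + w * q) ^ 2) = 0 := by
    have : 2 * q + q ^ 2 + b * (t * q + w + w * q) ^ 2
        = (1 + b * (t + w) ^ 2) * q ^ 2 + 2 * B * q + b * w ^ 2 := by rw [hB]; ring
    rw [this]
    have h2 : (B + s) ^ 2 * ((1 + b * (t + w) ^ 2) * q ^ 2 + 2 * B * q + b * w ^ 2)
      = (1 + b * (t + w) ^ 2) * (q * (B + s)) ^ 2 + 2 * B * (B + s) * (q * (B + s))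
        + b * w ^ 2 * (B + s) ^ 2 := by ring
    rw [h2, hqs]
    linear_combination b * w ^ 2 * hs
  exact (mul_eq_zero.1 key).resolve_left (pow_ne_zero 2 h0)

theorem isOpen_radiusDomain (hI : IsOpen I) (r : ℝ) : IsOpen (radiusDomain I r) := by
  have hc : Continuous fun p : ℝ × ℝ => r ^ 2 + 2 * p.1 * p.2 + p.2 ^ 2 := by fun_prop
  exact (isOpen_lt continuous_const hc).inter (hI.preimage hc.sqrt)

theorem contDiffOn_radius (I : Set ℝ) (r : ℝ) : ContDiffOn ℝ ∞ (radius r) (radiusDomain I r) :=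
  ContDiffOn.sqrt (by fun_prop) fun _ hp => hp.1.ne'

theorem isOpen_setOf_and {X : Type*} [TopologicalSpace X] {U : Set X} (hU : IsOpen U) {g : X → ℝ}
    (hg : ContinuousOn g U) : IsOpen {p | p ∈ U ∧ 0 < g p} :=
  hg.isOpen_inter_preimage hU isOpen_Ioi

theorem contDiffOn_warp_radius (hI_pos : I ⊆ Ioi 0)
    (hf : ContDiffOn ℝ ∞ f I) (hf_pos : ∀ t ∈ I, 0 < f t) :
    ContDiffOn ℝ ∞ (fun p => warp f (radius r p)) (radiusDomain I r) :=
  (contDiffOn_warp hI_pos hf hf_pos).comp (contDiffOn_radius I r) fun _ hp => hp.2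

theorem contDiffOn_slopeLinear (hI_pos : I ⊆ Ioi 0)
    (hf : ContDiffOn ℝ ∞ f I) (hf_pos : ∀ t ∈ I, 0 < f t) :
    ContDiffOn ℝ ∞ (slopeLinear f r) (radiusDomain I r) :=
  contDiffOn_const.add (((contDiffOn_warp_radius hI_pos hf hf_pos).mul contDiffOn_snd).mul
    (contDiffOn_fst.add contDiffOn_snd))

theorem contDiffOn_slopeDisc (hI_pos : I ⊆ Ioi 0)
    (hf : ContDiffOn ℝ ∞ f I) (hf_pos : ∀ t ∈ I, 0 < f t) :
    ContDiffOn ℝ ∞ (slopeDisc f r) (radiusDomain I r) :=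
  ((contDiffOn_slopeLinear hI_pos hf hf_pos).pow 2).sub
    ((contDiffOn_const.add ((contDiffOn_warp_radius hI_pos hf hf_pos).mul
      ((contDiffOn_fst.add contDiffOn_snd).pow 2))).mul
      ((contDiffOn_warp_radius hI_pos hf hf_pos).mul (contDiffOn_snd.pow 2)))

theorem isOpen_slopeDomain (hI : IsOpen I) (hI_pos : I ⊆ Ioi 0)
    (hf : ContDiffOn ℝ ∞ f I) (hf_pos : ∀ t ∈ I, 0 < f t) (r : ℝ) :
    IsOpen (slopeDomain I f r) := by
  have h := (isOpen_setOf_and (isOpen_radiusDomain hI r)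
    (contDiffOn_slopeLinear (r := r) hI_pos hf hf_pos).continuousOn).inter
    (isOpen_setOf_and (isOpen_radiusDomain hI r)
      (contDiffOn_slopeDisc (r := r) hI_pos hf hf_pos).continuousOn)
  convert h using 1
  ext p
  simp only [slopeDomain, mem_ofPred_eq, mem_inter_iff]
  tauto

theorem contDiffOn_slopeCoeff (hI_pos : I ⊆ Ioi 0)
    (hf : ContDiffOn ℝ ∞ f I) (hf_pos : ∀ t ∈ I, 0 < f t) :
    ContDiffOn ℝ ∞ (slopeCoeff f r) (slopeDomain I f r) := by
  have hsub : slopeDomain I f r ⊆ radiusDomain I r := fun _ hp => hp.1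
  exact ((contDiffOn_warp_radius hI_pos hf hf_pos).mono hsub).neg.div
    (((contDiffOn_slopeLinear hI_pos hf hf_pos).mono hsub).add
      (((contDiffOn_slopeDisc hI_pos hf hf_pos).mono hsub).sqrt fun _ hp => hp.2.2.ne'))
    fun _ hp => (add_pos_of_pos_of_nonneg hp.2.1 (Real.sqrt_nonneg _)).ne'

theorem contDiffOn_slope (hI_pos : I ⊆ Ioi 0)
    (hf : ContDiffOn ℝ ∞ f I) (hf_pos : ∀ t ∈ I, 0 < f t) :
    ContDiffOn ℝ ∞ (slope f r) (slopeDomain I f r) :=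
  (contDiffOn_snd.pow 2).mul (contDiffOn_slopeCoeff hI_pos hf hf_pos)

theorem radius_apply_zero (hr : 0 < r) (t : ℝ) : radius r (t, 0) = r := by
  simp [radius, Real.sqrt_sq hr.le]

theorem radius_pole {w : ℝ} (hw : 0 ≤ r + w) : radius r (r, w) = r + w := by
  rw [radius, ← Real.sqrt_sq hw]
  congr 1
  ring

theorem mem_slopeDomain_zero (hr0 : 0 < r) (hr : r ∈ I) (t : ℝ) :
    (t, (0 : ℝ)) ∈ slopeDomain I f r := by
  refine ⟨⟨by simpa using pow_pos hr0 2, by rwa [radius_apply_zero hr0]⟩, ?_, ?_⟩ <;>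
    simp [slopeLinear, slopeDisc]

theorem slope_apply_zero (f : ℝ → ℝ) (r t : ℝ) : slope f r (t, 0) = 0 := by simp [slope]

/-- The lower bound for the second fundamental form of an isometric shifted sphere. -/
def convexityGap (f : ℝ → ℝ) (r : ℝ) (p : ℝ × ℝ) : ℝ :=
  hessNorm (f (radius r p)) (warp f (radius r p)) r p.1 p.2 (slope f r p)
    - |hessAxis (f (radius r p)) (warp f (radius r p)) (deriv (warp f) (radius r p) /
      (2 * radius r p)) r p.1 p.2 (slope f r p) (along (slope f r) (slope f r) p)|

/-- The support function of an isometric shifted sphere. -/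
def slopeSupport (f : ℝ → ℝ) (r : ℝ) (p : ℝ × ℝ) : ℝ := support r p.1 p.2 (slope f r p)

theorem continuousOn_slopeSupport (hI_pos : I ⊆ Ioi 0)
    (hf : ContDiffOn ℝ ∞ f I) (hf_pos : ∀ t ∈ I, 0 < f t) :
    ContinuousOn (slopeSupport f r) (slopeDomain I f r) := by
  have h1 := (contDiffOn_slope (r := r) hI_pos hf hf_pos).continuousOn
  unfold slopeSupport support
  simp only [div_eq_mul_inv]
  fun_prop

theorem continuousOn_convexityGap (hI : IsOpen I) (hI_pos : I ⊆ Ioi 0)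
    (hf : ContDiffOn ℝ ∞ f I) (hf_pos : ∀ t ∈ I, 0 < f t) :
    ContinuousOn (convexityGap f r) (slopeDomain I f r) := by
  have hsub : slopeDomain I f r ⊆ radiusDomain I r := fun _ hp => hp.1
  have hU := isOpen_slopeDomain hI hI_pos hf hf_pos r
  have hq := contDiffOn_slope (r := r) hI_pos hf hf_pos
  have hq₂ := (contDiffOn_along hU hq hq).continuousOn
  have hS := continuousOn_slopeSupport (r := r) hI_pos hf hf_pos
  have hρ := (contDiffOn_radius I r).continuousOn.mono hsub
  have hF : ContinuousOn (fun p => f (radius r p)) (slopeDomain I f r) :=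
    hf.continuousOn.comp hρ fun _ hp => hp.1.2
  have hb := (contDiffOn_warp_radius (r := r) hI_pos hf hf_pos).continuousOn.mono hsub
  have hb' : ContinuousOn (fun p => deriv (warp f) (radius r p)) (slopeDomain I f r) :=
    ((contDiffOn_warp hI_pos hf hf_pos).continuousOn_deriv_of_isOpen hI (by simp)).comp hρ
      fun _ hp => hp.1.2
  have hc : ContinuousOn (fun p => deriv (warp f) (radius r p) / (2 * radius r p))
      (slopeDomain I f r) :=
    hb'.div (continuousOn_const.mul hρ)
      fun _ hp => (mul_pos two_pos (mem_Ioi.1 (hI_pos hp.1.2))).ne'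
  -- Opaque functions in place of the composite expressions reduce continuity to the algebraic shape
  -- of the formula.
  have key (F b c S q q₂ : ℝ × ℝ → ℝ) {D : Set (ℝ × ℝ)} (_ : ContinuousOn F D)
      (_ : ContinuousOn b D) (_ : ContinuousOn c D) (_ : ContinuousOn S D) (_ : ContinuousOn q D)
      (_ : ContinuousOn q₂ D) : ContinuousOn (fun p => r * (1 + q p) - F p ^ 2 * b p * r ^ 2 * S p
        - |-(p.1 * r * q₂ p) - F p ^ 2 * S p * r ^ 2 *
          (c p * (p.1 * q p + p.2 + p.2 * q p) ^ 2 + b p * (2 * q p + q p ^ 2))|) D := by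
    fun_prop
  exact key _ _ _ _ _ _ hF hb hc hS hq.continuousOn hq₂

theorem slopeSupport_apply_zero (hr : 0 < r) (t : ℝ) : slopeSupport f r (t, 0) = r := by
  simp only [slopeSupport, support, slope_apply_zero]
  field_simp
  ring

/-- On the axis the surface is the slice: the `⟪e, v⟫²` coefficient vanishes and only the positive
`‖v‖²` coefficient is left. -/
theorem convexityGap_apply_zero (hI : IsOpen I) (hI_pos : I ⊆ Ioi 0)
    (hf : ContDiffOn ℝ ∞ f I) (hf_pos : ∀ t ∈ I, 0 < f t) (hr0 : 0 < r) (hr : r ∈ I) (t : ℝ) :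
    convexityGap f r (t, 0) = r * f r ^ 2 := by
  have hS := slopeSupport_apply_zero (f := f) hr0 t
  simp only [slopeSupport, slope_apply_zero] at hS
  have hfr := (hf_pos r hr).ne'
  rw [convexityGap, along_apply_zero (isOpen_slopeDomain hI hI_pos hf hf_pos r)
    (contDiffOn_slope hI_pos hf hf_pos) (slope_apply_zero f r)
    (fun t _ => slope_apply_zero f r t) (mem_slopeDomain_zero hr0 hr t)]
  simp only [hessNorm, hessAxis, slope_apply_zero, radius_apply_zero hr0, hS, warp]
  simp
  field_simp
  ring

/-- The points of the slope domain at which the shifted sphere is embedded and convex. -/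
def goodDomain (I : Set ℝ) (f : ℝ → ℝ) (r : ℝ) : Set (ℝ × ℝ) :=
  {p | p ∈ slopeDomain I f r ∧ 0 < 1 + slope f r p ∧ 0 < slopeSupport f r p ∧
    0 < convexityGap f r p}

theorem isOpen_goodDomain (hI : IsOpen I) (hI_pos : I ⊆ Ioi 0)
    (hf : ContDiffOn ℝ ∞ f I) (hf_pos : ∀ t ∈ I, 0 < f t) (r : ℝ) : IsOpen (goodDomain I f r) := by
  have hU := isOpen_slopeDomain hI hI_pos hf hf_pos r
  have h := ((isOpen_setOf_and hU (continuousOn_const (c := (1 : ℝ)) |>.add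
    (contDiffOn_slope (r := r) hI_pos hf hf_pos).continuousOn)).inter
    (isOpen_setOf_and hU (continuousOn_slopeSupport (r := r) hI_pos hf hf_pos))).inter
    (isOpen_setOf_and hU (continuousOn_convexityGap (r := r) hI hI_pos hf hf_pos))
  convert h using 1
  ext p
  simp only [goodDomain, mem_ofPred_eq, mem_inter_iff]
  tauto

/-- The second fundamental form at the pole differs from that of the slice for small shifts. -/
theorem eventually_hessNorm_pole_ne (hI : IsOpen I) (hI_pos : I ⊆ Ioi 0)
    (hf : ContDiffOn ℝ ∞ f I) (hf_pos : ∀ t ∈ I, 0 < f t) (hr : r ∈ I)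
    (hne : f r * deriv f r / r + (1 - f r ^ 2) / r ^ 2 ≠ 0) :
    ∀ᶠ w in nhdsWithin (0 : ℝ) {0}ᶜ,
      hessNorm (f (r + w)) (warp f (r + w)) r r w (slope f r (r, w)) ≠ r * f r * f (r + w) := by
  have hr0 : 0 < r := hI_pos hr
  have hfr := (hf_pos r hr).ne'
  have hadd : HasDerivAt (fun w : ℝ => r + w) 1 0 := (hasDerivAt_id (0 : ℝ)).const_add r
  have hF : HasDerivAt (fun w => f (r + w)) (deriv f r) 0 := by
    have h1 : HasDerivAt f (deriv f r) (r + 0) := by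
      rw [add_zero]
      exact ((hf.contDiffAt (hI.mem_nhds hr)).differentiableAt (by simp)).hasDerivAt
    exact (h1.comp (0 : ℝ) hadd).congr_deriv (mul_one _)
  -- The factor `w²` makes the slope negligible to first order.
  have hq : HasDerivAt (fun w => slope f r (r, w)) 0 0 := by
    have h1 : DifferentiableAt ℝ (fun w => slopeCoeff f r (r, w)) 0 := by
      have h2 := ((contDiffOn_slopeCoeff (r := r) hI_pos hf hf_pos).contDiffAt
        ((isOpen_slopeDomain hI hI_pos hf hf_pos r).mem_nhds
          (mem_slopeDomain_zero hr0 hr r))).differentiableAt (by simp)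
      exact h2.comp (0 : ℝ) ((differentiableAt_const r).prodMk differentiableAt_id)
    have := ((hasDerivAt_id (0 : ℝ)).pow 2).mul h1.hasDerivAt
    exact this.congr_deriv (by simp)
  -- At the pole the support is `r + w`, so `hessNorm` equals `r(1 + q) - (1 - f(r + w)²) r² / (r +
  -- w)`. The difference of the two sides has derivative `r f f' + 1 - f²` at `w = 0`, which is `r²`
  -- times the expression in `hne`.
  have h := ((((hq.const_add 1).const_mul r).sub
    (((hF.pow 2).const_sub 1 |>.mul_const (r ^ 2)).div hadd (by simpa using hr0.ne'))).sub
      (hF.const_mul (r * f r))).eventually_ne (c := 0) (by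
        simp only [add_zero, Pi.pow_apply]
        intro h0
        apply hne
        field_simp at h0 ⊢
        linear_combination h0)
  have hpos : ∀ᶠ w in nhds (0 : ℝ), r + w ∈ I :=
    hadd.continuousAt.eventually_mem (hI.mem_nhds (by simpa using hr))
  filter_upwards [h, hpos.filter_mono nhdsWithin_le_nhds] with w hw hwI heq
  apply hw
  have h1 := (hf_pos _ hwI).ne'
  have h2 : r + w ≠ 0 := (mem_Ioi.1 (hI_pos hwI)).ne'
  rw [hessNorm, warp, support] at heq
  simp only [Pi.sub_apply, Pi.div_apply, Pi.pow_apply]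
  rw [sub_eq_zero, ← heq]
  field_simp
  ring

end Slope

/-! ### Existence of the height function. -/

section Existence

variable {I : Set ℝ} {f : ℝ → ℝ} {r : ℝ}

/-- `W` is the height function of an isometric, embedded and strictly convex shifted sphere. -/
structure IsGoodHeight (I : Set ℝ) (f : ℝ → ℝ) (r R : ℝ) (W : ℝ → ℝ) : Prop where
  lt : r < R
  contDiffOn : ContDiffOn ℝ ∞ W (Ioo (-R) R)
  mem : ∀ t ∈ Ioo (-R) R, (t, W t) ∈ goodDomain I f r
  deriv_eq : ∀ t ∈ Ioo (-R) R, deriv W t = slope f r (t, W t)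
  deriv_deriv_eq : ∀ t ∈ Ioo (-R) R,
    deriv (deriv W) t = along (slope f r) (slope f r) (t, W t)

theorem exists_isGoodHeight (hI : IsOpen I) (hI_pos : I ⊆ Ioi 0) (hf : ContDiffOn ℝ ∞ f I)
    (hf_pos : ∀ t ∈ I, 0 < f t) (hr : r ∈ I)
    (hne : f r * deriv f r / r + (1 - f r ^ 2) / r ^ 2 ≠ 0) (k : ℕ) {η : ℝ} (hη : 0 < η) :
    ∃ R W, IsGoodHeight I f r R W ∧ 0 < W r ∧
      (∀ t ∈ Ioo (-R) R, ∀ j ≤ k, |iteratedDeriv j W t| < η) ∧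
      hessNorm (f (r + W r)) (warp f (r + W r)) r r (W r) (slope f r (r, W r))
        ≠ r * f r * f (r + W r) := by
  have hr0 : 0 < r := hI_pos hr
  have hsub : goodDomain I f r ⊆ slopeDomain I f r := fun _ hp => hp.1
  have hgood := isOpen_goodDomain hI hI_pos hf hf_pos r
  have hG := (contDiffOn_slope (r := r) hI_pos hf hf_pos).mono hsub
  have hmem (t : ℝ) : (t, (0 : ℝ)) ∈ goodDomain I f r := by
    refine ⟨mem_slopeDomain_zero hr0 hr t, by simp [slope_apply_zero], ?_, ?_⟩
    · rwa [slopeSupport_apply_zero hr0]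
    · rw [convexityGap_apply_zero hI hI_pos hf hf_pos hr0 hr]
      exact mul_pos hr0 (pow_pos (hf_pos r hr) 2)
  -- Solving inside `smallSet` over `goodDomain` gives every open requirement at once, since the
  -- whole graph of `W` stays there.
  obtain ⟨R, hR, ε₀, hε₀, hsol⟩ := exists_small_solution (isOpen_smallSet hgood hG k η) hr0
    (fun t _ => ⟨hmem t, fun j _ => by
      rwa [iterate_along_apply_zero hgood hG (slope_apply_zero f r) j t (hmem t), abs_zero]⟩)
    ((contDiffOn_slopeCoeff (r := r) hI_pos hf hf_pos).mono fun p hp => hsub hp.1)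
  have hpole : ∀ᶠ w in nhdsWithin (0 : ℝ) (Ioi 0),
      hessNorm (f (r + w)) (warp f (r + w)) r r w (slope f r (r, w)) ≠ r * f r * f (r + w) :=
    (eventually_hessNorm_pole_ne hI hI_pos hf hf_pos hr hne).filter_mono
      (nhdsWithin_mono _ fun _ hx => ne_of_gt hx)
  -- The pole condition holds for all small `ε > 0`, so it is compatible with the smallness required
  -- by the ODE.
  obtain ⟨ε, hεpole, hε⟩ := (hpole.and (Ioo_mem_nhdsGT hε₀)).exists
  obtain ⟨W, hWr, hW, hWt⟩ := hsol ε hε.1 hε.2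
  have hder (t : ℝ) (ht : t ∈ Ioo (-R) R) : HasDerivAt W (slope f r (t, W t)) t := (hWt t ht).2
  refine ⟨R, W, ⟨hR, hW, fun t ht => (hWt t ht).1.1, fun t ht => (hder t ht).deriv,
    fun t ht => ?_⟩, hWr ▸ hε.1, fun t ht j hj => ?_, by rwa [hWr]⟩
  · have hev : deriv W =ᶠ[nhds t] fun s => slope f r (s, W s) :=
      Filter.eventually_of_mem (Ioo_mem_nhds ht.1 ht.2) fun s hs => (hder s hs).deriv
    rw [hev.deriv_eq]
    exact (hasDerivAt_comp_along hgood hG (hWt t ht).1.1 (hder t ht)).deriv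
  · rw [iteratedDeriv_eq_iterate_along hgood hG isOpen_Ioo
      (fun s hs => ⟨(hWt s hs).1.1, hder s hs⟩) j t ht]
    exact (hWt t ht).1.2 j hj

end Existence

/-! ### Geometric consequences for the shifted sphere. -/

section GoodHeight

variable {m : ℕ} {e : E (m + 1)} {I : Set ℝ} {f : ℝ → ℝ} {r R : ℝ} {W : ℝ → ℝ}

theorem height_mem_Ioo (he : ‖e‖ = 1) (hr : 0 < r) (hR : r < R) (p : S m) :
    r * ⟪e, (p : E (m + 1))⟫ ∈ Ioo (-R) R := by
  have h := abs_real_inner_le_norm e (p : E (m + 1))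
  rw [he, norm_coe_sphere, one_mul] at h
  have := abs_le.1 h
  constructor <;> nlinarith

theorem norm_shiftedSphere (he : ‖e‖ = 1) (p : S m) :
    ‖shiftedSphere e r W p‖
      = radius r (r * ⟪e, (p : E (m + 1))⟫, W (r * ⟪e, (p : E (m + 1))⟫)) := by
  rw [radius, ← norm_shiftMap_sq he (norm_coe_sphere p), Real.sqrt_sq (norm_nonneg _)]
  rfl

namespace IsGoodHeight

theorem norm_mem (h : IsGoodHeight I f r R W) (he : ‖e‖ = 1) (hr : 0 < r) (p : S m) :
    ‖shiftedSphere e r W p‖ ∈ I := by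
  rw [norm_shiftedSphere he]
  exact (h.mem _ (height_mem_Ioo he hr h.lt p)).1.1.2

theorem contDiffAt (h : IsGoodHeight I f r R W) (he : ‖e‖ = 1) (hr : 0 < r) (p : S m) :
    ContDiffAt ℝ ∞ W (r * ⟪e, (p : E (m + 1))⟫) :=
  h.contDiffOn.contDiffAt (isOpen_Ioo.mem_nhds (height_mem_Ioo he hr h.lt p))

theorem isEmbeddedSphere (h : IsGoodHeight I f r R W) (he : ‖e‖ = 1) (hr : 0 < r) :
    IsEmbeddedSphere (m := m) I (shiftedSphere e r W) :=
  isEmbeddedSphere_shiftedSphere he hr h.lt h.contDiffOn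
    (fun t ht => by rw [h.deriv_eq t ht]; exact (h.mem t ht).2.1) (h.norm_mem he hr)

theorem isOuterUnitNormal (h : IsGoodHeight I f r R W) (he : ‖e‖ = 1) (hr : 0 < r)
    (hf_pos : ∀ t ∈ I, 0 < f t) :
    IsOuterUnitNormal (m := m) f (shiftedSphere e r W) (shiftedNormal f e r W) := by
  refine isOuterUnitNormal_shiftedNormal he hr.ne' (fun p => (hf_pos _ (h.norm_mem he hr p)).ne')
    (fun p => (h.contDiffAt he hr p).differentiableAt (by simp)) fun p => ?_
  have ht := height_mem_Ioo he hr h.lt p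
  rw [h.deriv_eq _ ht]
  exact (h.mem _ ht).2.2.1

theorem firstForm_eq (h : IsGoodHeight I f r R W) (he : ‖e‖ = 1) (hr : 0 < r) (p : S m)
    {u v : E (m + 1)} (hu : IsTangent p u) (hv : IsTangent p v) :
    firstForm f (shiftedSphere e r W) p u v = r ^ 2 * ⟪u, v⟫ := by
  have ht := height_mem_Ioo he hr h.lt p
  refine firstForm_shiftedSphere he ((h.contDiffAt he hr p).differentiableAt (by simp)) ?_ hu hv
  rw [h.deriv_eq _ ht, norm_shiftedSphere he]
  exact isIsometricSlope_slope (h.mem _ ht).1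

theorem secondForm_eq (h : IsGoodHeight I f r R W) (he : ‖e‖ = 1) (hr : 0 < r) (hI : IsOpen I)
    (hI_pos : I ⊆ Ioi 0) (hf : ContDiffOn ℝ ∞ f I) (hf_pos : ∀ t ∈ I, 0 < f t) (p : S m)
    {v : E (m + 1)} (hv : IsTangent p v) {P : ℝ × ℝ}
    (hP : P = (r * ⟪e, (p : E (m + 1))⟫, W (r * ⟪e, (p : E (m + 1))⟫))) :
    secondForm f (shiftedSphere e r W) (shiftedNormal f e r W) p v v =
      (conormalLength f (shiftedSphere e r W p) (shiftNormal e (slope f r P) (p : E (m + 1))))⁻¹ *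
        (hessNorm (f (radius r P)) (warp f (radius r P)) r P.1 P.2 (slope f r P) * ‖v‖ ^ 2
          + hessAxis (f (radius r P)) (warp f (radius r P)) (deriv (warp f) (radius r P) /
            (2 * radius r P)) r P.1 P.2 (slope f r P) (along (slope f r) (slope f r) P)
            * ⟪e, v⟫ ^ 2) := by
  have ht := height_mem_Ioo he hr h.lt p
  have hρ := h.norm_mem he hr p
  have hb := (((contDiffOn_warp hI_pos hf hf_pos).contDiffAt
    (hI.mem_nhds hρ)).differentiableAt (by simp)).hasDerivAt
  have := secondForm_shiftedSphere he hr.ne' (h.contDiffAt he hr p)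
    (norm_pos_iff.1 (hI_pos hρ)) (hf_pos _ hρ).ne' hb hv rfl rfl (h.deriv_eq _ ht)
    (h.deriv_deriv_eq _ ht)
  rw [norm_shiftedSphere he, ← hP] at this
  rw [this, hP]

/-- As `⟪e, v⟫² ≤ ‖v‖²`, the form is bounded below by a positive multiple of `convexityGap` times
`‖v‖²`. -/
theorem isConvex (h : IsGoodHeight I f r R W) (he : ‖e‖ = 1) (hr : 0 < r) (hI : IsOpen I)
    (hI_pos : I ⊆ Ioi 0) (hf : ContDiffOn ℝ ∞ f I) (hf_pos : ∀ t ∈ I, 0 < f t) :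
    IsConvex (m := m) f (shiftedSphere e r W) (shiftedNormal f e r W) := by
  intro p v hv hv0
  have ht := height_mem_Ioo he hr h.lt p
  have hgood := h.mem _ ht
  have hρ := h.norm_mem he hr p
  rw [h.secondForm_eq he hr hI hI_pos hf hf_pos p hv rfl]
  have hn : 0 < ⟪shiftedSphere e r W p,
      shiftNormal e (slope f r (r * ⟪e, (p : E (m + 1))⟫, W (r * ⟪e, (p : E (m + 1))⟫)))
        (p : E (m + 1))⟫ :=
    hgood.2.2.1.trans_eq (inner_shiftNormal_position he (norm_coe_sphere p) hr.ne').symm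
  have hL := Real.sqrt_pos.2 (inner_conormalDual_self_pos (norm_pos_iff.1 (hI_pos hρ))
    (hf_pos _ hρ).ne' hn.ne')
  refine mul_pos (inv_pos.2 hL) ?_
  have hgap : 0 < convexityGap f r _ := hgood.2.2.2
  rw [convexityGap, sub_pos] at hgap
  have hev : ⟪e, v⟫ ^ 2 ≤ ‖v‖ ^ 2 := by
    have := abs_real_inner_le_norm e v
    rw [he, one_mul] at this
    exact sq_le_sq' (by linarith [(abs_le.1 this).1]) (abs_le.1 this).2
  have hv2 : 0 < ‖v‖ ^ 2 := pow_pos (norm_pos_iff.2 hv0) 2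
  generalize hessNorm _ _ _ _ _ _ = P at hgap ⊢
  generalize hessAxis _ _ _ _ _ _ _ _ = Q at hgap ⊢
  have h1 : -|Q| * ‖v‖ ^ 2 ≤ Q * ⟪e, v⟫ ^ 2 := by
    have h2 := mul_le_mul_of_nonneg_left hev (abs_nonneg Q)
    have h3 := mul_le_mul_of_nonneg_right (neg_abs_le Q) (sq_nonneg ⟪e, v⟫)
    linarith
  have h4 := mul_lt_mul_of_pos_right hgap hv2
  linarith

/-- With `e = p`, tangent vectors are orthogonal to the axis, so the axis term drops out; the
conormal is radial, of length `f (r + W r)`. -/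
theorem secondForm_pole (h : IsGoodHeight I f r R W) (hr : 0 < r) (hI : IsOpen I)
    (hI_pos : I ⊆ Ioi 0) (hf : ContDiffOn ℝ ∞ f I) (hf_pos : ∀ t ∈ I, 0 < f t) (hW : 0 ≤ W r)
    {p : S m} {v : E (m + 1)} (hv : IsTangent p v) (hv1 : ‖v‖ = 1) :
    secondForm f (shiftedSphere (p : E (m + 1)) r W) (shiftedNormal f (p : E (m + 1)) r W) p v v =
      (f (r + W r))⁻¹ *
        hessNorm (f (r + W r)) (warp f (r + W r)) r r (W r) (slope f r (r, W r)) := by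
  have hp := norm_coe_sphere p
  have hpp : ⟪(p : E (m + 1)), (p : E (m + 1))⟫ = 1 := by
    rw [real_inner_self_eq_norm_sq, hp, one_pow]
  have hv' : ⟪(p : E (m + 1)), v⟫ = 0 := hv
  have hrW : 0 < r + W r := by linarith
  rw [h.secondForm_eq hp hr hI hI_pos hf hf_pos p hv (P := (r, W r)) (by simp), hv1, hv',
    radius_pole hrW.le]
  have hY : shiftedSphere (p : E (m + 1)) r W p = (r + W r) • (p : E (m + 1)) := by
    simp [shiftedSphere, shiftMap, add_smul]
  have hn (q : ℝ) : shiftNormal (p : E (m + 1)) q (p : E (m + 1)) = p := by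
    rw [shiftNormal, hpp]
    module
  have hI' : r + W r ∈ I := by
    have := h.norm_mem hp hr p
    rwa [hY, norm_smul, hp, mul_one, Real.norm_of_nonneg hrW.le] at this
  have hL : conormalLength f ((r + W r) • (p : E (m + 1))) p = f (r + W r) := by
    have hfp := hf_pos _ hI'
    rw [conormalLength, conormalDual, inner_sub_left, inner_smul_left, inner_smul_left, norm_smul,
      hp, hpp, mul_one, Real.norm_of_nonneg hrW.le, warp, ← Real.sqrt_sq hfp.le]
    congr 1
    rw [Real.sqrt_sq hfp.le]
    simp only [conj_trivial, mul_one]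
    field_simp
    ring
  rw [hY, hn, hL]
  ring

end IsGoodHeight

/-- The pole forces `ρ = r + W r > r`. A point of the image orthogonal to `e` has `W t = -t`, hence
squared norm `r² - t² ≤ r² < ρ²`, so `ρ e'` is missed. -/
theorem range_shiftedSphere_ne_sphere (he : ‖e‖ = 1) (hr : 0 < r) (hW : 0 < W r)
    {e' : E (m + 1)} (he' : ‖e'‖ = 1) (hee' : ⟪e, e'⟫ = 0) (ρ : ℝ) :
    range (shiftedSphere (m := m) e r W) ≠ Metric.sphere 0 ρ := by
  intro heq
  have hee : ⟪e, e⟫ = 1 := by rw [real_inner_self_eq_norm_sq, he, one_pow]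
  have hpole : shiftedSphere e r W ⟨e, by simpa using he⟩ = (r + W r) • e := by
    simp [shiftedSphere, shiftMap, he, add_smul]
  have h1 : (r + W r) • e ∈ Metric.sphere (0 : E (m + 1)) ρ := by
    rw [← heq, ← hpole]
    exact mem_range_self _
  rw [mem_sphere_zero_iff_norm, norm_smul, he, mul_one, Real.norm_of_nonneg (by linarith)] at h1
  have h2 : ρ • e' ∈ range (shiftedSphere (m := m) e r W) := by
    rw [heq, mem_sphere_zero_iff_norm, norm_smul, he', mul_one, Real.norm_of_nonneg (by linarith)]
  obtain ⟨p, hp⟩ := h2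
  have h3 : r * ⟪e, (p : E (m + 1))⟫ + W (r * ⟪e, (p : E (m + 1))⟫) = 0 := by
    have := congrArg (fun x => ⟪e, x⟫) hp
    simpa [shiftedSphere, shiftMap, inner_add_right, inner_smul_right, he, hee'] using this
  have h4 := norm_shiftMap_sq (r := r) (W := W) he (norm_coe_sphere p)
  rw [show shiftMap e r W p = ρ • e' from hp, norm_smul, he', mul_one, Real.norm_eq_abs,
    sq_abs] at h4
  nlinarith [sq_nonneg (r * ⟪e, (p : E (m + 1))⟫)]

/-- This makes the slice a special case of the shifted spheres, so its normal and both its forms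
come from the same formulas. -/
theorem isGoodHeight_zero (hI : IsOpen I) (hI_pos : I ⊆ Ioi 0) (hf : ContDiffOn ℝ ∞ f I)
    (hf_pos : ∀ t ∈ I, 0 < f t) (hr : r ∈ I) : IsGoodHeight I f r (r + 1) 0 := by
  have hr0 : 0 < r := hI_pos hr
  refine ⟨by linarith, contDiffOn_const, fun t _ => ?_, fun t _ => ?_, fun t _ => ?_⟩
  · refine ⟨mem_slopeDomain_zero hr0 hr t, by simp [slope_apply_zero], ?_, ?_⟩
    · rwa [Pi.zero_apply, slopeSupport_apply_zero hr0]
    · rw [Pi.zero_apply, convexityGap_apply_zero hI hI_pos hf hf_pos hr0 hr]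
      exact mul_pos hr0 (pow_pos (hf_pos r hr) 2)
  · simp [slope_apply_zero]
  · rw [Pi.zero_apply, along_apply_zero (isOpen_slopeDomain hI hI_pos hf hf_pos r)
      (contDiffOn_slope hI_pos hf hf_pos) (slope_apply_zero f r)
      (fun t _ => slope_apply_zero f r t) (mem_slopeDomain_zero hr0 hr t)]
    simp

end GoodHeight

end WarpedProduct

end

theorem mainTheorem12 (m : ℕ) (hm : 1 ≤ m) (I : Set ℝ) (hI : IsOpen I) (hI_pos : I ⊆ Set.Ioi 0)
    (f : ℝ → ℝ) (hf : ContDiffOn ℝ ∞ f I) (hf_pos : ∀ t ∈ I, 0 < f t)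
    (r : ℝ) (hr : r ∈ I)
    (hne : f r * deriv f r / r + (1 - f r ^ 2) / r ^ 2 ≠ 0)
    (k : ℕ) (δ : ℝ) (hδ : 0 < δ) :
    WarpedProduct.HasConstantScalarCurvature m
        (WarpedProduct.firstForm f (WarpedProduct.slice m r)) ((m : ℝ) * (m - 1) / r ^ 2) ∧
    ∃ Y ν ν₀ : WarpedProduct.S m → WarpedProduct.E (m + 1),
      WarpedProduct.IsEmbeddedSphere I Y ∧
      WarpedProduct.CkClose k δ Y (WarpedProduct.slice m r) ∧
      WarpedProduct.IsOuterUnitNormal f Y ν ∧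
      WarpedProduct.IsOuterUnitNormal f (WarpedProduct.slice m r) ν₀ ∧
      WarpedProduct.IsConvex f Y ν ∧
      (∀ p : WarpedProduct.S m, ∀ u v, WarpedProduct.IsTangent p u → WarpedProduct.IsTangent p v →
        WarpedProduct.firstForm f Y p u v
          = WarpedProduct.firstForm f (WarpedProduct.slice m r) p u v) ∧
      WarpedProduct.HasConstantScalarCurvature m (WarpedProduct.firstForm f Y)
        ((m : ℝ) * (m - 1) / r ^ 2) ∧
      (∃ p : WarpedProduct.S m, ∃ u v, WarpedProduct.IsTangent p u ∧ WarpedProduct.IsTangent p v ∧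
        WarpedProduct.secondForm f Y ν p u v
          ≠ WarpedProduct.secondForm f (WarpedProduct.slice m r) ν₀ p u v) ∧
      ∀ ρ : ℝ, Set.range Y ≠ Metric.sphere (0 : WarpedProduct.E (m + 1)) ρ := by
  open WarpedProduct in
  have hr0 : 0 < r := hI_pos hr
  set e : E (m + 1) := EuclideanSpace.single (Fin.last m) 1 with he_def
  set e' : E (m + 1) := EuclideanSpace.single 0 1 with he'_def
  have he : ‖e‖ = 1 := by simp [he_def]
  have he' : ‖e'‖ = 1 := by simp [he'_def]
  -- The two basis vectors are distinct because `m ≥ 1`.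
  have hee' : ⟪e, e'⟫ = 0 := by
    have h0 : (0 : Fin (m + 1)) ≠ Fin.last m := by
      rw [Ne, Fin.ext_iff, Fin.val_zero, Fin.val_last]
      omega
    simp [he_def, he'_def, EuclideanSpace.inner_single_left, h0.symm]
  obtain ⟨C, hC, hbound⟩ := exists_ckClose_bound he r k
  obtain ⟨R, W, h, hW, hsmall, hpole⟩ :=
    -- This `η` bounds the `C^k` distance by `C η = δ / 2`, strictly below `δ`.
    exists_isGoodHeight hI hI_pos hf hf_pos hr hne k (η := δ / (2 * C)) (by positivity)
  have h₀ := isGoodHeight_zero hI hI_pos hf hf_pos hr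
  have hfirst₀ (p : S m) (u v : E (m + 1)) (hu : IsTangent p u) (hv : IsTangent p v) :
      firstForm f (slice m r) p u v = r ^ 2 * ⟪u, v⟫ := by
    rw [← shiftedSphere_zero e r]
    exact h₀.firstForm_eq he hr0 p hu hv
  have hfirst (p : S m) (u v : E (m + 1)) (hu : IsTangent p u) (hv : IsTangent p v) :
      firstForm f (shiftedSphere e r W) p u v = r ^ 2 * ⟪u, v⟫ := h.firstForm_eq he hr0 p hu hv
  refine ⟨hasConstantScalarCurvature_of_eq hr0.ne' hfirst₀, shiftedSphere e r W,
    shiftedNormal f e r W, shiftedNormal f e r 0, h.isEmbeddedSphere he hr0, fun j hj p => ?_,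
    h.isOuterUnitNormal he hr0 hf_pos, ?_, h.isConvex he hr0 hI hI_pos hf hf_pos,
    fun p u v hu hv => (hfirst p u v hu hv).trans (hfirst₀ p u v hu hv).symm,
    hasConstantScalarCurvature_of_eq hr0.ne' hfirst,
    ⟨⟨e, by simpa using he⟩, e', e', hee', hee', ?_⟩,
    fun ρ => range_shiftedSphere_ne_sphere he hr0 hW he' hee' ρ⟩
  · calc _ ≤ C * (δ / (2 * C)) := hbound W _ _ isOpen_Ioo h.contDiffOn
          (height_mem_Ioo he hr0 h.lt)
          (fun i hi q => (hsmall _ (height_mem_Ioo he hr0 h.lt q) i hi).le) j hj p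
      _ = δ / 2 := by field_simp
      _ < δ := half_lt_self hδ
  · rw [← shiftedSphere_zero e r]
    exact h₀.isOuterUnitNormal he hr0 hf_pos
  -- Both forms are evaluated at the pole on the unit tangent vector `e'`; the slice gives `r f(r)`,
  -- so equality would contradict `hpole`.
  · have hfr := (hf_pos r hr).ne'
    have h1 := h.secondForm_pole (p := ⟨e, by simpa using he⟩) hr0 hI hI_pos hf hf_pos hW.le
      hee' he'
    have h2 := h₀.secondForm_pole (p := ⟨e, by simpa using he⟩) hr0 hI hI_pos hf hf_pos le_rfl
      hee' he'
    have hfY : f (r + W r) ≠ 0 := by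
      have := (h.mem r ⟨by linarith [h.lt], h.lt⟩).1.1.2
      rw [radius_pole (by linarith)] at this
      exact (hf_pos _ this).ne'
    have h3 : (f r)⁻¹ * hessNorm (f r) (warp f r) r r 0 0 = r * f r := by
      rw [hessNorm, support, warp]
      field_simp
      ring
    simp only [Pi.zero_apply, add_zero, slope_apply_zero] at h2
    rw [← shiftedSphere_zero e r, h1, h2, h3]
    intro heq
    apply hpole
    field_simp at heq
    linarith
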